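/- Let $d\ge 2$ be an integer. Put $a_c=\frac{d-2}{2}$, $\vartheta(p,d)=\frac{d(p-2)}{2p}$ and \[ \underline a(\theta,p)=a_c-\frac{2\sqrt{d-1}}{p+2}\sqrt{\frac{2p\theta}{p-2}-1}. \] For $a<a_c$ let $\mathcal D^{1,2}_a(\mathbb R^d)$ be the completion of the set of smooth real-valued functions with compact support in $\mathbb R^d\setminus\{0\}$ with respect to the norm $\big(\||x|^{-a}\nabla u\|_{L^2(\mathbb R^d)}^2+\||x|^{-(a+1)}u\|_{L^2(\mathbb R^d)}^2\big)^{1/2}$. For $p>2$ (with $p<\frac{2d}{d-2}$ if $d\ge3$), $\theta\in[\vartheta(p,d),1]$ and $a<a_c$, let $b$ be given by $p=\frac{2d}{d-2+2(b-a)}$, and consider the Caffarelli--Kohn--Nirenberg inequality \[ \Big(\int_{\mathbb R^d}\frac{|u|^p}{|x|^{bp}}\,dx\Big)^{2/p}\le \mathsf C\,\Big(\int_{\mathbb R^d}\frac{|\nabla u|^2}{|x|^{2a}}\,dx\Big)^{\theta}\Big(\int_{\mathbb R^d}\frac{|u|^2}{|x|^{2(a+1)}}\,dx\Big)^{1-\theta}\qquad\text{for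 all }u\in\mathcal D^{1,2}_a(\mathbb R^d), \] where $\mathsf C=\mathsf C(\theta,p,a,d)$ denotes the optimal (smallest) constant. An extremal for the parameters $(\theta,p,a)$ is a function $u\in\mathcal D^{1,2}_a(\mathbb R^d)$, $u\not\equiv0$, for which equality holds. Theorem. There exists $\eta>0$ such that for every $p\in(2,2+\eta)$ there exists $\varepsilon>0$ with the following property: for all $\theta\in[\vartheta(p,d),\vartheta(p,d)+\varepsilon)$ and all $a\in[\underline a(\theta,p),\underline a(\theta,p)+\varepsilon)$, no extremal for the parameters $(\theta,p,a)$ is radially symmetric (that is, almost everywhere equal to a function of $|x|$). All these parameters are admissible: $\theta<1$ (so that $\vartheta(p,d)<1$, i.e. $p<\frac{2d}{d-2}$ if $d\ge3$) and $a<a_c$. -/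

import Mathlib

open MeasureTheory Filter Topology
open scoped ENNReal ContDiff

noncomputable section

namespace CKN

/-- The critical value `a_c = (d - 2) / 2`. -/
def aCrit (d : ℕ) : ℝ := ((d : ℝ) - 2) / 2

/-- The limiting exponent `ϑ(p, d) = d (p - 2) / (2 p)`. -/
def vartheta (p : ℝ) (d : ℕ) : ℝ := d * (p - 2) / (2 * p)

/-- The exponent `p(a, b) = 2 d / (d - 2 + 2 (b - a))`. -/
def pExp (d : ℕ) (a b : ℝ) : ℝ := 2 * d / ((d : ℝ) - 2 + 2 * (b - a))

/-- The curve `a̲(θ, p) = a_c - (2 √(d-1) / (p+2)) √(2 p θ / (p-2) - 1)`. -/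
def aBar (d : ℕ) (θ p : ℝ) : ℝ :=
  aCrit d - 2 * √((d : ℝ) - 1) / (p + 2) * √(2 * p * θ / (p - 2) - 1)

/-- Smooth functions with compact support contained in `ℝ^d \ {0}`. -/
def IsTestFunction {d : ℕ} (φ : EuclideanSpace ℝ (Fin d) → ℝ) : Prop :=
  ContDiff ℝ ∞ φ ∧ HasCompactSupport φ ∧ (0 : EuclideanSpace ℝ (Fin d)) ∉ tsupport φ

/-- The weighted Dirichlet energy `∫ |G|² / |x|^{2a} dx` of a vector field. -/
def gradEnergy {d : ℕ} (a : ℝ)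
    (G : EuclideanSpace ℝ (Fin d) → EuclideanSpace ℝ (Fin d)) : ℝ≥0∞ :=
  ∫⁻ x, ENNReal.ofReal (‖G x‖ ^ 2 * ‖x‖ ^ (-(2 * a)))

/-- The weighted mass `∫ |u|² / |x|^{2(a+1)} dx`. -/
def mass {d : ℕ} (a : ℝ) (u : EuclideanSpace ℝ (Fin d) → ℝ) : ℝ≥0∞ :=
  ∫⁻ x, ENNReal.ofReal (|u x| ^ 2 * ‖x‖ ^ (-(2 * (a + 1))))

/-- The weighted `p`-th power integral `∫ |u|^p / |x|^{bp} dx`. -/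
def pMass {d : ℕ} (b p : ℝ) (u : EuclideanSpace ℝ (Fin d) → ℝ) : ℝ≥0∞ :=
  ∫⁻ x, ENNReal.ofReal (|u x| ^ p * ‖x‖ ^ (-(b * p)))

/-- `MemD a u G`: the function `u` belongs to `D_a^{1,2}(ℝ^d)`, and `G` is its gradient.
The completion of the test functions is realised inside the complete space
`L²(|x|^{-2(a+1)} dx) × L²(|x|^{-2a} dx; ℝ^d)` as the closure of the set of pairs `(φ, ∇φ)`. The
field `G` is determined almost everywhere by `u`: both weights are bounded below on compact subsets
of `ℝ^d \ {0}`, so that `G` is the distributional gradient of `u` there. -/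
def MemD {d : ℕ} (a : ℝ) (u : EuclideanSpace ℝ (Fin d) → ℝ)
    (G : EuclideanSpace ℝ (Fin d) → EuclideanSpace ℝ (Fin d)) : Prop :=
  AEStronglyMeasurable u volume ∧ AEStronglyMeasurable G volume ∧
    ∃ φ : ℕ → EuclideanSpace ℝ (Fin d) → ℝ,
      (∀ n, IsTestFunction (φ n)) ∧
      Tendsto (fun n => mass a (fun x => φ n x - u x)) atTop (𝓝 0) ∧
      Tendsto (fun n => gradEnergy a (fun x => gradient (φ n) x - G x)) atTop (𝓝 0)

/-- The optimal constant: the infimum of all `C` such that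
`(∫ |u|^p / |x|^{bp})^{2/p} ≤ C (∫ |∇u|² / |x|^{2a})^θ (∫ |u|² / |x|^{2(a+1)})^{1-θ}`
for every `u ∈ D_a^{1,2}(ℝ^d)`. -/
def optConst (d : ℕ) (θ p a b : ℝ) : ℝ≥0∞ :=
  sInf {C : ℝ≥0∞ | ∀ (u : EuclideanSpace ℝ (Fin d) → ℝ)
    (G : EuclideanSpace ℝ (Fin d) → EuclideanSpace ℝ (Fin d)), MemD a u G →
      pMass b p u ^ (2 / p) ≤ C * (gradEnergy a G ^ θ * mass a u ^ (1 - θ))}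

/-- Extremals: the nonzero functions of `D_a^{1,2}(ℝ^d)` which attain equality in the inequality
with its optimal constant. -/
def IsExtremal {d : ℕ} (θ p a b : ℝ) (u : EuclideanSpace ℝ (Fin d) → ℝ) : Prop :=
  ¬ (u =ᵐ[volume] 0) ∧
    ∃ G : EuclideanSpace ℝ (Fin d) → EuclideanSpace ℝ (Fin d), MemD a u G ∧
      pMass b p u ^ (2 / p) = optConst d θ p a b * (gradEnergy a G ^ θ * mass a u ^ (1 - θ))

/-- Radial symmetry (about the origin) of the almost-everywhere class of `u`. -/
def IsRadial {d : ℕ} (u : EuclideanSpace ℝ (Fin d) → ℝ) : Prop :=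
  ∃ f : ℝ → ℝ, u =ᵐ[volume] fun x => f ‖x‖

end CKN

end

/-!
At the limiting exponent `θ = ϑ(p, d)` the inequality has the same homogeneity as the
Gagliardo-Nirenberg inequality without weights. Test functions which concentrate at a point `e ≠ 0`
do not feel the weights, so the optimal constant is at least the Gagliardo-Nirenberg quotient of any
function, in particular of a Gaussian. It therefore suffices to show that, at `θ = ϑ(p, d)` and
`a = aBar d ϑ(p, d) p` and for `p` close to `2`, the best constant for radial functions is strictly
smaller than the quotient of the Gaussian. Both sides depend continuously on `(θ, a)`, provided one
fixes the test function, so that the strict inequality persists for nearby parameters, and there no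
radial function can attain the optimal constant.

*Upper bound for radial functions.* Along a ray, the Emden-Fowler substitution
`w t = e ^ (κ t) φ (e ^ t σ)` with `κ = a_c - a` turns the inequality into one for
`∫ (w' ^ 2 + κ ^ 2 w ^ 2)`, `∫ w ^ 2` and `∫ |w| ^ p` on the line (`interpolation_ray`). It follows
from the one-dimensional Gagliardo-Nirenberg inequality `gagliardo_nirenberg_line`, whose constant
is explicit and good enough in the limit `p → 2`. By Hölder's inequality it may be integrated over
the sphere for an arbitrary test function (`lintegral_rayMass_le`). The resulting inequality for a
mixed norm passes to all of `D_a^{1,2}` by Fatou's lemma (`MemD.lintegral_rayMass_le`), without any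
use of weak derivatives in polar coordinates; for radial functions the mixed norm is a multiple of
the weighted `L^p` norm (`MemD.pMass_le_of_isRadial`).

*Lower bound.* The quotients of truncated Gaussians of width `1 / n` at a unit vector converge to
the quotient of the Gaussian by dominated convergence (`exists_isTestFunction_quotient`).

*Comparison.* Both constants tend to `1` as `p → 2`, and one compares their powers of exponent
`2 p / (p - 2)`. What remains is a lower bound for the area of the sphere (`pi_exp_rpow_lt`),
equivalently a Stirling-type upper bound for the Gamma function at half-integers (`sq_Gamma_le`).
-/

/-! ### A one-dimensional Gagliardo-Nirenberg inequality -/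

namespace CKN

lemma integrable_comp_of_hasCompactSupport {w φ : ℝ → ℝ} (hw : Continuous w)
    (hc : HasCompactSupport w) (hφ : Continuous φ) (h0 : φ 0 = 0) :
    Integrable (fun t => φ (w t)) :=
  Continuous.integrable_of_hasCompactSupport (hφ.comp hw) (hc.comp_left h0)

lemma two_mul_le_integral_abs_deriv {q : ℝ → ℝ} (hq : ContDiff ℝ 1 q) (hc : HasCompactSupport q)
    (t : ℝ) : 2 * q t ≤ ∫ x, |deriv q x| := by
  have hi : Integrable (fun x => |deriv q x|) :=
    ((hq.continuous_deriv le_rfl).integrable_of_hasCompactSupport hc.deriv).abs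
  have h1 : q t ≤ ∫ x in Set.Iic t, |deriv q x| := by
    rw [← HasCompactSupport.integral_Iic_deriv_eq hq hc t]
    exact (le_abs_self _).trans (abs_integral_le_integral_abs (f := deriv q))
  have h2 : q t ≤ ∫ x in Set.Ioi t, |deriv q x| := by
    have := HasCompactSupport.integral_Ioi_deriv_eq hq hc t
    have h3 : q t = - ∫ x in Set.Ioi t, deriv q x := by rw [this]; ring
    rw [h3]
    exact (neg_le_abs _).trans (abs_integral_le_integral_abs (f := deriv q))
  have h3 := setIntegral_univ (μ := volume) (f := fun x => |deriv q x|)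
  rw [← Set.Iic_union_Ioi (a := t), setIntegral_union (Set.Iic_disjoint_Ioi le_rfl)
    measurableSet_Ioi hi.integrableOn hi.integrableOn] at h3
  linarith

/-- The constant `27 / 32` comes from Bernoulli's inequality `τ ^ k ≤ 1 + k (τ - 1)` together with
`32 - 27 (1 - τ) (1 + τ) ^ 2 = (3 τ - 1) ^ 2 (3 τ + 5)`. -/
lemma one_sub_rpow_ge {k τ : ℝ} (hk0 : 0 < k) (hk1 : k ≤ 1) (h0 : 0 ≤ τ) (h1 : τ ≤ 1) :
    27 / 32 * k * (1 - τ ^ 2) ^ 2 ≤ 1 - τ ^ k := by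
  have hb := rpow_one_add_le_one_add_mul_self (s := τ - 1) (by linarith) hk0.le hk1
  rw [add_sub_cancel] at hb
  have h2 : 0 ≤ k * ((1 - τ) * ((3 * τ - 1) ^ 2 * (3 * τ + 5))) := by
    have : 0 ≤ 1 - τ := by linarith
    positivity
  nlinarith

/-- The estimate behind the one-dimensional inequality: let `M = max |w|`. The function
`q = w ^ 2 - w ^ 4 / (2 M ^ 2)` has maximum `M ^ 2 / 2` and derivative
`2 w w' (1 - (w / M) ^ 2)`, so that `M ^ 2 ≤ ∫ |q'|`, and Young's inequality together with
`one_sub_rpow_ge` bounds `|q'|` by `w' ^ 2` and `w ^ 2 - M ^ (2 - p) |w| ^ p`. -/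
lemma calibration_estimate {w : ℝ → ℝ} (hw : ContDiff ℝ 1 w) (hc : HasCompactSupport w)
    {p y M t₀ : ℝ} (hp2 : 2 < p) (hp3 : p ≤ 3) (hy : 0 < y) (hM : 0 < M) (hMt : |w t₀| = M)
    (hle : ∀ t, |w t| ≤ M) :
    √(27 / 32 * (p - 2)) * M ^ 2 ≤ y * (∫ t, (deriv w t) ^ 2) +
      (1 / y) * ((∫ t, (w t) ^ 2) - (M ^ (p - 2))⁻¹ * ∫ t, |w t| ^ p) := by
  set γ := √(27 / 32 * (p - 2)) with hγ
  have hγ2 : γ ^ 2 = 27 / 32 * (p - 2) := Real.sq_sqrt (by linarith)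
  have hγ0 : 0 ≤ γ := Real.sqrt_nonneg _
  set q : ℝ → ℝ := fun t => w t ^ 2 - w t ^ 4 / (2 * M ^ 2) with hq
  have hqd : ContDiff ℝ 1 q := by fun_prop
  have hqc : HasCompactSupport q :=
    hc.comp_left (g := fun x : ℝ => x ^ 2 - x ^ 4 / (2 * M ^ 2)) (by simp)
  have hw' : Continuous (deriv w) := hw.continuous_deriv le_rfl
  have hderiv : ∀ t, deriv q t = 2 * w t * deriv w t * (1 - (|w t| / M) ^ 2) := by
    intro t
    have h := (hw.differentiable one_ne_zero t).hasDerivAt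
    have h2 := (h.fun_pow 2).fun_sub ((h.fun_pow 4).div_const (2 * M ^ 2))
    rw [div_pow, sq_abs]
    refine (h2.congr_deriv ?_).deriv
    simp only [Nat.cast_ofNat]
    field_simp
    ring
  have hp0 : 0 < p := by linarith
  have iX : Integrable (fun t => (deriv w t) ^ 2) :=
    integrable_comp_of_hasCompactSupport (φ := fun x => x ^ 2) hw' hc.deriv (by fun_prop) (by simp)
  have iY : Integrable (fun t => (w t) ^ 2) :=
    integrable_comp_of_hasCompactSupport (φ := fun x => x ^ 2) hw.continuous hc (by fun_prop)
      (by simp)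
  have iP : Integrable (fun t => |w t| ^ p) :=
    integrable_comp_of_hasCompactSupport (φ := fun x => |x| ^ p) hw.continuous hc
      (continuous_abs.rpow_const fun _ => Or.inr hp0.le) (by simp [hp0.ne'])
  have iD : Integrable (fun t => (w t) ^ 2 - (M ^ (p - 2))⁻¹ * |w t| ^ p) :=
    iY.sub (iP.const_mul _)
  have hpt : ∀ t, γ * |deriv q t| ≤
      y * (deriv w t) ^ 2 + (1 / y) * ((w t) ^ 2 - (M ^ (p - 2))⁻¹ * |w t| ^ p) := by
    intro t
    set τ := |w t| / M with hτ
    have hτ0 : 0 ≤ τ := by positivity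
    have hτ1 : τ ≤ 1 := (div_le_one hM).2 (hle t)
    have hwt : |w t| = M * τ := by rw [hτ]; field_simp
    have hcal := one_sub_rpow_ge (k := p - 2) (by linarith) (by linarith) hτ0 hτ1
    have h1 : (M ^ (p - 2))⁻¹ * |w t| ^ p = |w t| ^ 2 * τ ^ (p - 2) := by
      rcases hτ0.eq_or_lt with h | h
      · rw [hwt, ← h]; simp [hp0.ne']
      · rw [hwt, Real.mul_rpow hM.le hτ0, Real.rpow_sub hM, Real.rpow_sub h]
        norm_num [Real.rpow_ofNat]
        have : M ^ p ≠ 0 := by positivity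
        field_simp
    rw [h1, ← sq_abs (w t), hderiv, abs_mul, abs_mul, abs_mul, abs_of_nonneg (a := 1 - τ ^ 2)
      (by nlinarith), ← sq_abs (deriv w t)]
    have h2 : (γ * |w t| * (1 - τ ^ 2)) ^ 2 ≤ |w t| ^ 2 - |w t| ^ 2 * τ ^ (p - 2) := by
      have := mul_le_mul_of_nonneg_left hcal (sq_nonneg |w t|)
      rw [mul_pow, mul_pow, hγ2]
      linarith
    have h3 : 2 * (|deriv w t| * (γ * |w t| * (1 - τ ^ 2))) ≤
        y * |deriv w t| ^ 2 + (1 / y) * (γ * |w t| * (1 - τ ^ 2)) ^ 2 := by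
      have : 0 ≤ (1 / y) * (y * |deriv w t| - γ * |w t| * (1 - τ ^ 2)) ^ 2 := by positivity
      have e : (1 / y) * (y * |deriv w t| - γ * |w t| * (1 - τ ^ 2)) ^ 2 =
        y * |deriv w t| ^ 2 + (1 / y) * (γ * |w t| * (1 - τ ^ 2)) ^ 2 -
          2 * (|deriv w t| * (γ * |w t| * (1 - τ ^ 2))) := by field_simp; ring
      linarith
    have h4 : (1 / y) * (γ * |w t| * (1 - τ ^ 2)) ^ 2 ≤
        (1 / y) * (|w t| ^ 2 - |w t| ^ 2 * τ ^ (p - 2)) := by gcongr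
    rw [abs_two]
    linarith
  have hqt : 2 * q t₀ = M ^ 2 := by
    simp only [hq]
    have : w t₀ ^ 4 = (|w t₀| ^ 2) ^ 2 := by rw [sq_abs]; ring
    rw [this, ← sq_abs (w t₀), hMt]
    field_simp
    ring
  have h1 := two_mul_le_integral_abs_deriv hqd hqc t₀
  rw [hqt] at h1
  calc γ * M ^ 2 ≤ γ * ∫ t, |deriv q t| := by gcongr
    _ = ∫ t, γ * |deriv q t| := (integral_const_mul _ _).symm
    _ ≤ ∫ t, (y * (deriv w t) ^ 2 + (1 / y) * ((w t) ^ 2 - (M ^ (p - 2))⁻¹ * |w t| ^ p)) := by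
      refine integral_mono ?_ ?_ hpt
      · exact ((hqd.continuous_deriv le_rfl).integrable_of_hasCompactSupport
          hqc.deriv).abs.const_mul _
      · exact (iX.const_mul _).add (iD.const_mul _)
    _ = _ := by
      rw [integral_add (iX.const_mul _) (iD.const_mul _),
        integral_const_mul, integral_const_mul, integral_sub iY (iP.const_mul _),
        integral_const_mul]

/-- The maximum over `m` of the left-hand side, computed by the weighted AM-GM inequality. -/
lemma rpow_mul_rpow_sub_le {p m A B : ℝ} (hp : 2 < p) (hm : 0 ≤ m) (hB : 0 < B)
    (hA : 0 ≤ A - B * m) :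
    m ^ ((p - 2) / p) * (A - B * m) ^ (2 / p) ≤
      ((p - 2) / (2 * B)) ^ ((p - 2) / p) * (2 / p * A) := by
  have hp0 : 0 < p := by linarith
  have hk : 0 < p - 2 := by linarith
  have h := Real.geom_mean_le_arith_mean2_weighted (w₁ := (p - 2) / p) (w₂ := 2 / p)
    (p₁ := 2 * B / (p - 2) * m) (p₂ := A - B * m) (by positivity) (by positivity) (by positivity)
    hA (by field_simp; ring)
  rw [Real.mul_rpow (by positivity) hm] at h
  have e : (p - 2) / p * (2 * B / (p - 2) * m) + 2 / p * (A - B * m) = 2 / p * A := by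
    field_simp; ring
  rw [e] at h
  have e2 : ((p - 2) / (2 * B)) ^ ((p - 2) / p) * (2 * B / (p - 2)) ^ ((p - 2) / p) = 1 := by
    rw [← Real.mul_rpow (by positivity) (by positivity)]
    rw [show (p - 2) / (2 * B) * (2 * B / (p - 2)) = 1 by field_simp, Real.one_rpow]
  calc _ = ((p - 2) / (2 * B)) ^ ((p - 2) / p) * ((2 * B / (p - 2)) ^ ((p - 2) / p) *
        m ^ ((p - 2) / p) * (A - B * m) ^ (2 / p)) := by
        linear_combination -(m ^ ((p - 2) / p) * (A - B * m) ^ (2 / p)) * e2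
    _ ≤ _ := by gcongr

/-- A one-dimensional Gagliardo-Nirenberg inequality. To first order in `p - 2` the optimal
constant is obtained from this one on replacing `27 / 32` by `π / 2`. -/
theorem gagliardo_nirenberg_line {w : ℝ → ℝ} (hw : ContDiff ℝ 1 w) (hc : HasCompactSupport w)
    {p : ℝ} (hp2 : 2 < p) (hp3 : p ≤ 3) :
    (∫ t, |w t| ^ p) ^ (2 / p) ≤
      ((∫ t, (deriv w t) ^ 2) / (27 / 32 * Real.exp 1)) ^ ((p - 2) / (2 * p)) *
        (∫ t, (w t) ^ 2) ^ (1 - (p - 2) / (2 * p)) := by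
  have hp0 : 0 < p := by linarith
  have hk : 0 < p - 2 := by linarith
  set s := (p - 2) / (2 * p) with hs
  have hs0 : 0 < s := by positivity
  have hs1 : s < 1 := by rw [hs, div_lt_one (by positivity)]; linarith
  by_cases hw0 : ∀ t, w t = 0
  · simp [hw0, hp0.ne', Real.zero_rpow (show 2 / p ≠ 0 by positivity)]
    positivity
  push Not at hw0
  obtain ⟨t₁, ht₁⟩ := hw0
  obtain ⟨t₀, ht₀⟩ := hw.continuous.abs.exists_forall_ge_of_hasCompactSupport
    (hc.comp_left (g := fun x : ℝ => |x|) (by simp))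
  set M := |w t₀| with hMdef
  have hM : 0 < M := (abs_pos.2 ht₁).trans_le (ht₀ t₁)
  set X := ∫ t, (deriv w t) ^ 2 with hX
  set Y := ∫ t, (w t) ^ 2 with hY
  set P := ∫ t, |w t| ^ p with hP
  have hw' : Continuous (deriv w) := hw.continuous_deriv le_rfl
  have hYpos : 0 < Y :=
    (hw.continuous.pow 2).integral_pos_of_hasCompactSupport_nonneg_nonzero
      (hc.comp_left (g := fun x : ℝ => x ^ 2) (by simp)) (fun t => sq_nonneg _)
      (x := t₁) (pow_ne_zero 2 ht₁)
  have hXpos : 0 < X := by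
    obtain ⟨t, ht⟩ : ∃ t, deriv w t ≠ 0 := by
      by_contra! h
      have hconst := is_const_of_deriv_eq_zero (hw.differentiable one_ne_zero) h
      obtain ⟨t₂, ht₂⟩ : ∃ t, w t = 0 := by
        by_contra! h'
        have : Function.support w = Set.univ := Set.eq_univ_of_forall h'
        have h3 := hc.isCompact
        rw [tsupport, this, closure_univ] at h3
        exact noncompact_univ ℝ h3
      exact ht₁ ((hconst t₁ t₂).trans ht₂)
    exact (hw'.pow 2).integral_pos_of_hasCompactSupport_nonneg_nonzero
      (hc.deriv.comp_left (g := fun x : ℝ => x ^ 2) (by simp)) (fun t => sq_nonneg _)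
      (x := t) (pow_ne_zero 2 ht)
  have hP0 : 0 ≤ P := integral_nonneg fun t => by positivity
  -- the optimal dilation balances the two quadratic terms
  set y := √((p - 2) * Y / (4 * X)) with hy
  have hypos : 0 < y := Real.sqrt_pos.2 (by positivity)
  have hy2 : y ^ 2 = (p - 2) * Y / (4 * X) := Real.sq_sqrt (by positivity)
  have hcal := calibration_estimate hw hc hp2 hp3 hypos hM rfl ht₀
  set γ := √(27 / 32 * (p - 2)) with hγ
  have hγ2 : γ ^ 2 = 27 / 32 * (p - 2) := Real.sq_sqrt (by linarith)
  have hγpos : 0 < γ := Real.sqrt_pos.2 (by linarith)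
  have hmain : P ≤ M ^ (p - 2) * ((Y + y ^ 2 * X) - γ * y * M ^ 2) := by
    have hMk : 0 < M ^ (p - 2) := by positivity
    have h1 : (M ^ (p - 2))⁻¹ * P ≤ Y + y ^ 2 * X - γ * y * M ^ 2 := by
      have := mul_le_mul_of_nonneg_left hcal hypos.le
      have e : y * (y * X + 1 / y * (Y - (M ^ (p - 2))⁻¹ * P)) =
        y ^ 2 * X + (Y - (M ^ (p - 2))⁻¹ * P) := by field_simp
      rw [e] at this
      linarith
    calc P = M ^ (p - 2) * ((M ^ (p - 2))⁻¹ * P) := by field_simp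
      _ ≤ _ := by gcongr
  have hnn : 0 ≤ (Y + y ^ 2 * X) - γ * y * M ^ 2 := by
    by_contra! h
    have : M ^ (p - 2) * ((Y + y ^ 2 * X) - γ * y * M ^ 2) < 0 :=
      mul_neg_of_pos_of_neg (by positivity) h
    linarith
  have hA : 2 / p * (Y + y ^ 2 * X) = (1 - s) * Y := by
    rw [hy2, hs]; field_simp; ring
  have hB : ((p - 2) / (2 * (γ * y))) ^ ((p - 2) / p) = (X / (27 / 32 * Y)) ^ s := by
    have e : (p - 2) / p = 2 * s := by rw [hs]; field_simp
    rw [e, Real.rpow_mul (by positivity), Real.rpow_two]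
    congr 1
    rw [div_pow, mul_pow, mul_pow, hγ2, hy2]
    field_simp
    norm_num
  have h1 := rpow_mul_rpow_sub_le (p := p) (m := M ^ 2) (A := Y + y ^ 2 * X) (B := γ * y) hp2
    (by positivity) (by positivity) hnn
  rw [hA, hB] at h1
  have h2 : P ^ (2 / p) ≤ (X / (27 / 32 * Y)) ^ s * ((1 - s) * Y) := by
    refine le_trans ?_ h1
    calc P ^ (2 / p) ≤ (M ^ (p - 2) * ((Y + y ^ 2 * X) - γ * y * M ^ 2)) ^ (2 / p) := by gcongr
      _ = _ := by
        rw [Real.mul_rpow (by positivity) hnn, ← Real.rpow_mul hM.le]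
        congr 1
        rw [← Real.rpow_natCast M 2, ← Real.rpow_mul hM.le]
        congr 1
        push_cast
        ring
  refine h2.trans ?_
  have h3 : 1 - s ≤ (Real.exp 1)⁻¹ ^ s := by
    rw [← Real.exp_neg, ← Real.exp_mul]
    linarith [Real.add_one_le_exp (-1 * s)]
  calc (X / (27 / 32 * Y)) ^ s * ((1 - s) * Y)
      ≤ (X / (27 / 32 * Y)) ^ s * ((Real.exp 1)⁻¹ ^ s * Y) := by gcongr
    _ = _ := by
      have e1 : X / (27 / 32 * Y) * (Real.exp 1)⁻¹ = (X / (27 / 32 * Real.exp 1)) * Y⁻¹ := by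
        field_simp
      rw [← mul_assoc, ← Real.mul_rpow (by positivity) (by positivity), e1,
        Real.mul_rpow (by positivity) (by positivity), Real.rpow_sub hYpos, Real.rpow_one,
        Real.inv_rpow hYpos.le]
      field_simp

/-- The constant of the interpolation inequality on rays. With `s = (p - 2) / (2 p)`, the first
factor is that of `gagliardo_nirenberg_line`, the second one that of `rpow_mul_rpow_le_rpow_add`. -/
noncomputable def rayConst (p θ κ : ℝ) : ℝ :=
  (27 / 32 * Real.exp 1)⁻¹ ^ ((p - 2) / (2 * p)) *
    (((p - 2) / (2 * p)) ^ ((p - 2) / (2 * p)) *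
      ((θ - (p - 2) / (2 * p)) / κ ^ 2) ^ (θ - (p - 2) / (2 * p)) / θ ^ θ)

/-- Weighted AM-GM, with weights `s / θ` and `(θ - s) / θ`. -/
lemma rpow_mul_rpow_le_rpow_add {s θ Λ X Y : ℝ} (hs : 0 < s) (hθ : s < θ) (hΛ : 0 < Λ)
    (hX : 0 ≤ X) (hY : 0 ≤ Y) :
    X ^ s * Y ^ (θ - s) ≤
      s ^ s * ((θ - s) / Λ) ^ (θ - s) / θ ^ θ * (X + Λ * Y) ^ θ := by
  have hθ0 : 0 < θ := hs.trans hθ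
  have hθs : 0 < θ - s := by linarith
  have h := Real.geom_mean_le_arith_mean2_weighted (w₁ := s / θ) (w₂ := (θ - s) / θ)
    (p₁ := X / s) (p₂ := Λ * Y / (θ - s)) (by positivity) (by positivity) (by positivity)
    (by positivity) (by field_simp; ring)
  have e : s / θ * (X / s) + (θ - s) / θ * (Λ * Y / (θ - s)) = (X + Λ * Y) / θ := by
    field_simp
  rw [e] at h
  have h2 := Real.rpow_le_rpow (by positivity) h hθ0.le
  rw [Real.mul_rpow (by positivity) (by positivity), ← Real.rpow_mul (by positivity),
    ← Real.rpow_mul (by positivity), div_mul_cancel₀ _ hθ0.ne', div_mul_cancel₀ _ hθ0.ne',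
    Real.div_rpow (by positivity) hs.le, Real.div_rpow (by positivity) hθ0.le,
    Real.div_rpow (by positivity) hθs.le, Real.mul_rpow hΛ.le hY] at h2
  rw [Real.div_rpow hθs.le hΛ.le]
  have a1 : 0 < s ^ s := by positivity
  have a2 : 0 < (θ - s) ^ (θ - s) := by positivity
  have a3 : 0 < Λ ^ (θ - s) := by positivity
  calc X ^ s * Y ^ (θ - s) = s ^ s * ((θ - s) ^ (θ - s) / Λ ^ (θ - s)) *
        (X ^ s / s ^ s * (Λ ^ (θ - s) * Y ^ (θ - s) / (θ - s) ^ (θ - s))) := by field_simp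
    _ ≤ s ^ s * ((θ - s) ^ (θ - s) / Λ ^ (θ - s)) * ((X + Λ * Y) ^ θ / θ ^ θ) := by gcongr
    _ = _ := by ring

/-- The cross term in `(w' - κ w) ^ 2` is a derivative, so its integral vanishes. -/
theorem interpolation_line {w : ℝ → ℝ} (hw : ContDiff ℝ 1 w) (hc : HasCompactSupport w)
    {p θ κ : ℝ} (hp2 : 2 < p) (hp3 : p ≤ 3) (hθ : (p - 2) / (2 * p) < θ) (hκ : κ ≠ 0) :
    (∫ t, |w t| ^ p) ^ (2 / p) ≤
      rayConst p θ κ * ((∫ t, (deriv w t - κ * w t) ^ 2) ^ θ * (∫ t, (w t) ^ 2) ^ (1 - θ)) := by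
  have hp0 : 0 < p := by linarith
  have hs0 : 0 < (p - 2) / (2 * p) := by
    have : 0 < p - 2 := by linarith
    positivity
  have hw' : Continuous (deriv w) := hw.continuous_deriv le_rfl
  have iX : Integrable (fun t => (deriv w t) ^ 2) :=
    integrable_comp_of_hasCompactSupport (φ := fun x => x ^ 2) hw' hc.deriv (by fun_prop) (by simp)
  have iY : Integrable (fun t => (w t) ^ 2) :=
    integrable_comp_of_hasCompactSupport (φ := fun x => x ^ 2) hw.continuous hc (by fun_prop)
      (by simp)
  have hd : ∀ t, deriv (fun t => w t ^ 2) t = 2 * w t * deriv w t := by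
    intro t
    exact ((hw.differentiable one_ne_zero t).hasDerivAt.fun_pow 2 |>.congr_deriv (by simp)).deriv
  have hc2 : HasCompactSupport (fun t => w t ^ 2) :=
    hc.comp_left (g := fun x : ℝ => x ^ 2) (by simp)
  have hcd : ContDiff ℝ 1 (fun t => w t ^ 2) := hw.pow 2
  have hint0 : ∫ t, deriv (fun t => w t ^ 2) t = 0 :=
    integral_eq_zero_of_hasDerivAt_of_integrable
      (fun t => (hcd.differentiable one_ne_zero t).hasDerivAt)
      ((hcd.continuous_deriv le_rfl).integrable_of_hasCompactSupport hc2.deriv)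
      (hcd.continuous.integrable_of_hasCompactSupport hc2)
  have hE : ∫ t, (deriv w t - κ * w t) ^ 2 =
      (∫ t, (deriv w t) ^ 2) + κ ^ 2 * ∫ t, (w t) ^ 2 := by
    have e : ∀ t, (deriv w t - κ * w t) ^ 2 =
        ((deriv w t) ^ 2 + κ ^ 2 * (w t) ^ 2) - κ * deriv (fun t => w t ^ 2) t := by
      intro t; rw [hd]; ring
    have iA : Integrable (fun t => (deriv w t) ^ 2 + κ ^ 2 * (w t) ^ 2) :=
      iX.add (iY.const_mul _)
    simp_rw [e]
    rw [integral_sub iA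
      (((hcd.continuous_deriv le_rfl).integrable_of_hasCompactSupport hc2.deriv).const_mul _),
      integral_add iX (iY.const_mul _), integral_const_mul, integral_const_mul, hint0]
    ring
  rw [hE]
  have h1 := gagliardo_nirenberg_line hw hc hp2 hp3
  have hX : 0 ≤ ∫ t, (deriv w t) ^ 2 := integral_nonneg fun t => sq_nonneg _
  have hY : 0 ≤ ∫ t, (w t) ^ 2 := integral_nonneg fun t => sq_nonneg _
  set X := ∫ t, (deriv w t) ^ 2
  set Y := ∫ t, (w t) ^ 2
  rcases hY.eq_or_lt with hY0 | hY0
  · have : 1 - (p - 2) / (2 * p) ≠ 0 := by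
      have : (p - 2) / (2 * p) < 1 := by rw [div_lt_one (by positivity)]; linarith
      linarith
    rw [← hY0, Real.zero_rpow this, mul_zero] at h1
    refine h1.trans ?_
    have : 0 ≤ rayConst p θ κ := by
      have : 0 < θ := hs0.trans hθ
      have : 0 < θ - (p - 2) / (2 * p) := by linarith
      unfold rayConst; positivity
    positivity
  have h2 := rpow_mul_rpow_le_rpow_add (Λ := κ ^ 2) hs0 hθ (by positivity) hX hY
  set s := (p - 2) / (2 * p) with hs
  calc _ ≤ _ := h1
    _ = (27 / 32 * Real.exp 1)⁻¹ ^ s * (X ^ s * Y ^ (θ - s)) * Y ^ (1 - θ) := by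
      rw [div_eq_mul_inv, Real.mul_rpow hX (by positivity),
        show 1 - s = (θ - s) + (1 - θ) by ring, Real.rpow_add hY0]
      ring
    _ ≤ (27 / 32 * Real.exp 1)⁻¹ ^ s * (s ^ s * ((θ - s) / κ ^ 2) ^ (θ - s) / θ ^ θ *
        (X + κ ^ 2 * Y) ^ θ) * Y ^ (1 - θ) := by gcongr
    _ = _ := by rw [rayConst]; ring

end CKN

/-! ### The interpolation inequality on rays -/

namespace CKN

lemma lintegral_Ioi_eq_lintegral_exp (f : ℝ → ℝ≥0∞) :
    ∫⁻ r in Set.Ioi (0 : ℝ), f r = ∫⁻ t : ℝ, ENNReal.ofReal (Real.exp t) * f (Real.exp t) := by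
  have h := lintegral_image_eq_lintegral_abs_deriv_mul (s := Set.univ) (f := Real.exp)
    (f' := Real.exp) MeasurableSet.univ (fun x _ => (Real.hasDerivAt_exp x).hasDerivWithinAt)
    Real.exp_injective.injOn f
  rw [Set.image_univ, Real.range_exp] at h
  simpa [abs_of_pos (Real.exp_pos _)] using h

lemma rpow_exp (t c : ℝ) : Real.exp t ^ c = Real.exp (c * t) := by
  rw [← Real.exp_mul, mul_comm]

/-- The scaling relation between `p`, `a` and `b`, freed of its denominator. -/
lemma p_mul_eq {d : ℕ} {p a b : ℝ} (hp : 2 < p) (hb : p = pExp d a b) :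
    (aCrit d - a) * p = d - b * p := by
  unfold pExp at hb
  unfold aCrit
  have h0 : (d : ℝ) - 2 + 2 * (b - a) ≠ 0 := by
    intro h; rw [h, div_zero] at hb; linarith
  rw [eq_div_iff h0] at hb
  linarith

/-- The substitution `r = e ^ t`, `w t = e ^ (κ t) g (e ^ t)` turns `interpolation_line` into a
weighted inequality on the half-line. -/
theorem interpolation_ray {d : ℕ} (hd : 1 ≤ d) {g : ℝ → ℝ} (hg : ContDiff ℝ 1 g) {δ R : ℝ}
    (hδ : 0 < δ) (hsupp : ∀ r, 0 < r → g r ≠ 0 → δ ≤ r ∧ r ≤ R) {p θ a b : ℝ} (hp2 : 2 < p)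
    (hp3 : p ≤ 3) (hθ : (p - 2) / (2 * p) < θ) (hθ1 : θ < 1) (ha : a < aCrit d)
    (hb : p = pExp d a b) :
    (∫⁻ r in Set.Ioi (0 : ℝ), ENNReal.ofReal (|g r| ^ p * r ^ (-(b * p)))
        * ENNReal.ofReal (r ^ (d - 1))) ^ (2 / p) ≤
      ENNReal.ofReal (rayConst p θ (aCrit d - a)) *
        ((∫⁻ r in Set.Ioi (0 : ℝ), ENNReal.ofReal (|deriv g r| ^ 2 * r ^ (-(2 * a)))
          * ENNReal.ofReal (r ^ (d - 1))) ^ θ *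
        (∫⁻ r in Set.Ioi (0 : ℝ), ENNReal.ofReal (|g r| ^ 2 * r ^ (-(2 * (a + 1))))
          * ENNReal.ofReal (r ^ (d - 1))) ^ (1 - θ)) := by
  have hp0 : 0 < p := by linarith
  set κ := aCrit d - a with hκ
  have hκ0 : 0 < κ := by linarith
  have hκp : κ * p = d - b * p := p_mul_eq hp2 hb
  have hκa : 2 * κ = d - 2 - 2 * a := by rw [hκ, aCrit]; ring
  set w : ℝ → ℝ := fun t => Real.exp (κ * t) * g (Real.exp t) with hw
  have hwd : ContDiff ℝ 1 w := by
    have : ContDiff ℝ 1 (fun t => g (Real.exp t)) := hg.comp Real.contDiff_exp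
    fun_prop
  have hwc : HasCompactSupport w := by
    refine HasCompactSupport.of_support_subset_isCompact (isCompact_Icc (a := Real.log δ)
      (b := Real.log R)) fun t ht => ?_
    have : g (Real.exp t) ≠ 0 := right_ne_zero_of_mul ht
    obtain ⟨h1, h2⟩ := hsupp _ (Real.exp_pos t) this
    exact ⟨(Real.log_le_iff_le_exp hδ).2 h1,
      (Real.le_log_iff_exp_le ((Real.exp_pos t).trans_le h2)).2 h2⟩
  have hw' : ∀ t, deriv w t - κ * w t = Real.exp ((κ + 1) * t) * deriv g (Real.exp t) := by
    intro t
    have h1 : HasDerivAt (fun t => Real.exp (κ * t)) (Real.exp (κ * t) * κ) t := by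
      simpa using ((hasDerivAt_id t).const_mul κ).exp
    have h2 : HasDerivAt (fun t => g (Real.exp t)) (deriv g (Real.exp t) * Real.exp t) t :=
      (hg.differentiable one_ne_zero _).hasDerivAt.comp t (Real.hasDerivAt_exp t)
    rw [(h1.fun_mul h2).deriv, add_mul, Real.exp_add, one_mul]
    simp only [hw]
    ring
  have hdpow : ∀ t : ℝ, Real.exp t ^ (d - 1) = Real.exp ((d - 1) * t) := by
    intro t
    rw [← Real.exp_nat_mul]
    push_cast [Nat.cast_sub hd]
    rfl
  have e1 : ∀ t, ENNReal.ofReal (Real.exp t) * (ENNReal.ofReal (|g (Real.exp t)| ^ p *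
      Real.exp t ^ (-(b * p))) * ENNReal.ofReal (Real.exp t ^ (d - 1))) =
      ENNReal.ofReal (|w t| ^ p) := by
    intro t
    rw [← ENNReal.ofReal_mul (by positivity), ← ENNReal.ofReal_mul (by positivity), hw]
    simp only
    rw [abs_mul, Real.mul_rpow (abs_nonneg _) (abs_nonneg _), abs_of_pos (Real.exp_pos _),
      rpow_exp, rpow_exp, hdpow]
    have : Real.exp (p * (κ * t)) =
        Real.exp t * Real.exp (-(b * p) * t) * Real.exp ((d - 1) * t) := by
      rw [← Real.exp_add, ← Real.exp_add]
      congr 1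
      linear_combination t * hκp
    rw [this]
    ring_nf
  have e2 : ∀ t, ENNReal.ofReal (Real.exp t) * (ENNReal.ofReal (|deriv g (Real.exp t)| ^ 2 *
      Real.exp t ^ (-(2 * a))) * ENNReal.ofReal (Real.exp t ^ (d - 1))) =
      ENNReal.ofReal ((deriv w t - κ * w t) ^ 2) := by
    intro t
    rw [← ENNReal.ofReal_mul (by positivity), ← ENNReal.ofReal_mul (by positivity), hw',
      mul_pow, sq_abs, hdpow, rpow_exp, ← Real.exp_nat_mul]
    have : Real.exp ((2 : ℕ) * ((κ + 1) * t)) =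
        Real.exp t * Real.exp (-(2 * a) * t) * Real.exp ((d - 1) * t) := by
      rw [← Real.exp_add, ← Real.exp_add]
      congr 1
      push_cast
      linear_combination t * hκa
    rw [this]
    ring_nf
  have e3 : ∀ t, ENNReal.ofReal (Real.exp t) * (ENNReal.ofReal (|g (Real.exp t)| ^ 2 *
      Real.exp t ^ (-(2 * (a + 1)))) * ENNReal.ofReal (Real.exp t ^ (d - 1))) =
      ENNReal.ofReal (w t ^ 2) := by
    intro t
    rw [← ENNReal.ofReal_mul (by positivity), ← ENNReal.ofReal_mul (by positivity), hw]
    simp only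
    rw [mul_pow, sq_abs, hdpow, rpow_exp, ← Real.exp_nat_mul]
    have : Real.exp ((2 : ℕ) * (κ * t)) =
        Real.exp t * Real.exp (-(2 * (a + 1)) * t) * Real.exp ((d - 1) * t) := by
      rw [← Real.exp_add, ← Real.exp_add]
      congr 1
      push_cast
      linear_combination t * hκa
    rw [this]
    ring_nf
  rw [lintegral_Ioi_eq_lintegral_exp, lintegral_Ioi_eq_lintegral_exp,
    lintegral_Ioi_eq_lintegral_exp]
  simp_rw [e1, e2, e3]
  have hwd' : Continuous (deriv w) := hwd.continuous_deriv le_rfl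
  have i1 : Integrable (fun t => |w t| ^ p) :=
    integrable_comp_of_hasCompactSupport (φ := fun x => |x| ^ p) hwd.continuous hwc
      (continuous_abs.rpow_const fun _ => Or.inr hp0.le) (by simp [hp0.ne'])
  have i2 : Integrable (fun t => (deriv w t - κ * w t) ^ 2) :=
    integrable_comp_of_hasCompactSupport (φ := fun x => x ^ 2)
      (hwd'.sub (hwd.continuous.const_mul κ))
      (hwc.deriv.sub (hwc.mul_left (f := fun _ => κ))) (by fun_prop) (by simp)
  have i3 : Integrable (fun t => (w t) ^ 2) :=
    integrable_comp_of_hasCompactSupport (φ := fun x => x ^ 2) hwd.continuous hwc (by fun_prop)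
      (by simp)
  rw [← ofReal_integral_eq_lintegral_ofReal i1 (.of_forall fun t => by positivity),
    ← ofReal_integral_eq_lintegral_ofReal i2 (.of_forall fun t => by positivity),
    ← ofReal_integral_eq_lintegral_ofReal i3 (.of_forall fun t => by positivity)]
  have hθ0 : 0 < θ := by
    have : 0 < p - 2 := by linarith
    have : 0 < (p - 2) / (2 * p) := by positivity
    linarith
  have h1 : 0 ≤ ∫ t, |w t| ^ p := integral_nonneg fun t => by positivity
  have h2 : 0 ≤ ∫ t, (deriv w t - κ * w t) ^ 2 := integral_nonneg fun t => by positivity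
  have h3 : 0 ≤ ∫ t, (w t) ^ 2 := integral_nonneg fun t => by positivity
  rw [ENNReal.ofReal_rpow_of_nonneg h1 (by positivity),
    ENNReal.ofReal_rpow_of_nonneg h2 hθ0.le, ENNReal.ofReal_rpow_of_nonneg h3 (by linarith),
    ← ENNReal.ofReal_mul (by positivity), ← ENNReal.ofReal_mul' (by positivity)]
  exact ENNReal.ofReal_le_ofReal (interpolation_line hwd hwc hp2 hp3 hθ hκ0.ne')

/-! ### Polar coordinates -/

section Polar

variable {d : ℕ}

lemma lintegral_polar (hd : 1 ≤ d) {f : EuclideanSpace ℝ (Fin d) → ℝ≥0∞} (hf : Measurable f) :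
    ∫⁻ x, f x = ∫⁻ σ : Metric.sphere (0 : EuclideanSpace ℝ (Fin d)) 1,
      (∫⁻ r in Set.Ioi (0 : ℝ), f (r • (σ : EuclideanSpace ℝ (Fin d))) *
        ENNReal.ofReal (r ^ (d - 1))) ∂(volume : Measure (EuclideanSpace ℝ (Fin d))).toSphere := by
  have : NeZero d := ⟨by omega⟩
  have : Nontrivial (EuclideanSpace ℝ (Fin d)) := inferInstance
  have hm : Measurable (fun z : Metric.sphere (0 : EuclideanSpace ℝ (Fin d)) 1 × Set.Ioi (0 : ℝ) =>
      f ((z.2 : ℝ) • (z.1 : EuclideanSpace ℝ (Fin d)))) := by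
    refine hf.comp (Continuous.measurable ?_)
    fun_prop
  calc ∫⁻ x, f x = ∫⁻ x : ({0}ᶜ : Set (EuclideanSpace ℝ (Fin d))), f x
        ∂(volume.comap Subtype.val) := by
        rw [lintegral_subtype_comap (measurableSet_singleton _).compl, restrict_compl_singleton]
    _ = ∫⁻ z, f ((z.2 : ℝ) • (z.1 : EuclideanSpace ℝ (Fin d)))
        ∂((volume : Measure (EuclideanSpace ℝ (Fin d))).toSphere.prod
          (Measure.volumeIoiPow (d - 1))) := by
        have h := Measure.measurePreserving_homeomorphUnitSphereProd
          (volume : Measure (EuclideanSpace ℝ (Fin d)))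
        rw [finrank_euclideanSpace_fin] at h
        rw [← h.lintegral_comp hm]
        refine lintegral_congr fun x => ?_
        congr 1
        have := (homeomorphUnitSphereProd (EuclideanSpace ℝ (Fin d))).symm_apply_apply x
        conv_lhs => rw [← this]
        rfl
    _ = _ := by
        rw [lintegral_prod _ hm.aemeasurable]
        refine lintegral_congr fun σ => ?_
        rw [Measure.volumeIoiPow, lintegral_withDensity_eq_lintegral_mul _ (by fun_prop)]
        · rw [← lintegral_subtype_comap measurableSet_Ioi]
          refine lintegral_congr fun r => ?_
          simp [mul_comm]
        · exact hf.comp (Continuous.measurable (by fun_prop))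

lemma ae_polar (hd : 1 ≤ d) {Q : EuclideanSpace ℝ (Fin d) → Prop} (hQ : ∀ᵐ x, Q x) :
    ∀ᵐ σ : Metric.sphere (0 : EuclideanSpace ℝ (Fin d)) 1
      ∂(volume : Measure (EuclideanSpace ℝ (Fin d))).toSphere,
      ∀ᵐ r ∂(volume.restrict (Set.Ioi (0 : ℝ))), Q (r • (σ : EuclideanSpace ℝ (Fin d))) := by
  set N := toMeasurable volume {x | ¬ Q x} with hN
  have hNm : MeasurableSet N := measurableSet_toMeasurable _ _
  have hN0 : volume N = 0 := by rw [hN, measure_toMeasurable]; exact hQ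
  have hf : Measurable (N.indicator (1 : EuclideanSpace ℝ (Fin d) → ℝ≥0∞)) :=
    measurable_one.indicator hNm
  have h := lintegral_polar hd hf
  rw [lintegral_indicator_one hNm, hN0, eq_comm, lintegral_eq_zero_iff] at h
  · filter_upwards [h] with σ hσ
    simp only [Pi.zero_apply] at hσ
    rw [lintegral_eq_zero_iff] at hσ
    · filter_upwards [hσ, ae_restrict_mem measurableSet_Ioi] with r hr hr0
      by_contra hcon
      have hmem : r • (σ : EuclideanSpace ℝ (Fin d)) ∈ N := subset_toMeasurable _ _ hcon
      simp only [Set.indicator_of_mem hmem, Pi.one_apply, one_mul, Pi.zero_apply,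
        ENNReal.ofReal_eq_zero] at hr
      have : 0 < r ^ (d - 1) := pow_pos hr0 _
      linarith
    · have : Measurable fun r : ℝ => r • (σ : EuclideanSpace ℝ (Fin d)) := by fun_prop
      exact (hf.comp this).mul (by fun_prop)
  · refine Measurable.lintegral_prod_right'
      (f := fun z : Metric.sphere (0 : EuclideanSpace ℝ (Fin d)) 1 × ℝ =>
        N.indicator (1 : EuclideanSpace ℝ (Fin d) → ℝ≥0∞)
          (z.2 • (z.1 : EuclideanSpace ℝ (Fin d))) * ENNReal.ofReal (z.2 ^ (d - 1))) ?_
    refine (hf.comp (Continuous.measurable (by fun_prop))).mul (by fun_prop)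

end Polar

end CKN

/-! ### The interpolation inequality for radial functions -/

namespace CKN

variable {d : ℕ}

/-- The weighted `p`-th power integral of `u` along the ray spanned by the unit vector `σ`. -/
noncomputable def rayMass (b p : ℝ) (u : EuclideanSpace ℝ (Fin d) → ℝ)
    (σ : Metric.sphere (0 : EuclideanSpace ℝ (Fin d)) 1) : ℝ≥0∞ :=
  ∫⁻ r in Set.Ioi (0 : ℝ), ENNReal.ofReal
    (|u (r • (σ : EuclideanSpace ℝ (Fin d)))| ^ p *
      ‖r • (σ : EuclideanSpace ℝ (Fin d))‖ ^ (-(b * p))) * ENNReal.ofReal (r ^ (d - 1))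

lemma norm_smul_sphere (σ : Metric.sphere (0 : EuclideanSpace ℝ (Fin d)) 1) {r : ℝ} (hr : 0 < r) :
    ‖r • (σ : EuclideanSpace ℝ (Fin d))‖ = r := by
  rw [norm_smul, mem_sphere_zero_iff_norm.1 σ.2, mul_one, Real.norm_of_nonneg hr.le]

lemma IsTestFunction.continuous_gradient {φ : EuclideanSpace ℝ (Fin d) → ℝ}
    (hφ : IsTestFunction φ) : Continuous (gradient φ) :=
  (InnerProductSpace.toDual ℝ _).symm.continuous.comp (hφ.1.continuous_fderiv (by simp))

lemma IsTestFunction.exists_annulus {φ : EuclideanSpace ℝ (Fin d) → ℝ} (hφ : IsTestFunction φ) :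
    ∃ δ R : ℝ, 0 < δ ∧ ∀ x ∈ tsupport φ, δ ≤ ‖x‖ ∧ ‖x‖ ≤ R := by
  obtain ⟨R, hR⟩ := hφ.2.1.isCompact.isBounded.exists_norm_le
  obtain ⟨δ, hδ, hball⟩ := Metric.mem_nhds_iff.1
    ((isClosed_tsupport φ).isOpen_compl.mem_nhds hφ.2.2)
  refine ⟨δ, R, hδ, fun x hx => ⟨?_, hR x hx⟩⟩
  by_contra! h
  exact hball (by simpa using h) hx

lemma measurable_pIntegrand {b p : ℝ} {u : EuclideanSpace ℝ (Fin d) → ℝ} (hu : Measurable u) :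
    Measurable fun x => ENNReal.ofReal (|u x| ^ p * ‖x‖ ^ (-(b * p))) := by
  have : Measurable fun x => |u x| := hu.abs
  fun_prop

lemma measurable_rayIntegral {f : EuclideanSpace ℝ (Fin d) → ℝ≥0∞} (hf : Measurable f) :
    Measurable fun σ : Metric.sphere (0 : EuclideanSpace ℝ (Fin d)) 1 =>
      ∫⁻ r in Set.Ioi (0 : ℝ), f (r • (σ : EuclideanSpace ℝ (Fin d))) *
        ENNReal.ofReal (r ^ (d - 1)) := by
  refine Measurable.lintegral_prod_right'
    (f := fun z : Metric.sphere (0 : EuclideanSpace ℝ (Fin d)) 1 × ℝ =>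
      f (z.2 • (z.1 : EuclideanSpace ℝ (Fin d))) * ENNReal.ofReal (z.2 ^ (d - 1))) ?_
  exact (hf.comp (Continuous.measurable (by fun_prop))).mul (by fun_prop)

/-- Since the exponents `θ` and `1 - θ` add up to one, Hölder's inequality allows to integrate the
inequality on rays over the unit sphere. -/
theorem lintegral_rayMass_le (hd : 1 ≤ d) {φ : EuclideanSpace ℝ (Fin d) → ℝ}
    (hφ : IsTestFunction φ) {p θ a b : ℝ} (hp2 : 2 < p)
    (hp3 : p ≤ 3) (hθ : (p - 2) / (2 * p) < θ) (hθ1 : θ < 1) (ha : a < aCrit d)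
    (hb : p = pExp d a b) :
    ∫⁻ σ, rayMass b p φ σ ^ (2 / p) ∂(volume : Measure (EuclideanSpace ℝ (Fin d))).toSphere ≤
      ENNReal.ofReal (rayConst p θ (aCrit d - a)) *
        (gradEnergy a (gradient φ) ^ θ * mass a φ ^ (1 - θ)) := by
  have hp0 : 0 < p := by linarith
  have hθ0 : 0 < θ := by
    have : 0 < p - 2 := by linarith
    have : 0 < (p - 2) / (2 * p) := by positivity
    linarith
  obtain ⟨δ, R, hδ, hsupp⟩ := hφ.exists_annulus
  have hφc : Continuous φ := hφ.1.continuous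
  have hmG : Measurable fun x => ENNReal.ofReal (‖gradient φ x‖ ^ 2 * ‖x‖ ^ (-(2 * a))) := by
    have := hφ.continuous_gradient.measurable
    fun_prop
  have hmM : Measurable fun x => ENNReal.ofReal (|φ x| ^ 2 * ‖x‖ ^ (-(2 * (a + 1)))) := by
    have := hφc.measurable.abs
    fun_prop
  rw [gradEnergy, mass, lintegral_polar hd hmG, lintegral_polar hd hmM]
  refine le_trans ?_ (mul_le_mul_right (ENNReal.lintegral_mul_norm_pow_le
    (measurable_rayIntegral hmG).aemeasurable (measurable_rayIntegral hmM).aemeasurable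
    hθ0.le (by linarith) (by ring)) _)
  rw [← lintegral_const_mul' _ _ ENNReal.ofReal_ne_top]
  refine lintegral_mono fun σ => ?_
  have hnorm : ‖(σ : EuclideanSpace ℝ (Fin d))‖ = 1 := mem_sphere_zero_iff_norm.1 σ.2
  set g : ℝ → ℝ := fun r => φ (r • (σ : EuclideanSpace ℝ (Fin d))) with hg
  have hgd : ContDiff ℝ 1 g := by
    have : ContDiff ℝ 1 φ := hφ.1.of_le (by exact_mod_cast le_top)
    exact this.comp (by fun_prop)
  have hg' : ∀ r, |deriv g r| ≤ ‖gradient φ (r • (σ : EuclideanSpace ℝ (Fin d)))‖ := by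
    intro r
    have h1 : HasDerivAt (fun r : ℝ => r • (σ : EuclideanSpace ℝ (Fin d)))
        (σ : EuclideanSpace ℝ (Fin d)) r := by
      simpa using (hasDerivAt_id r).smul_const (σ : EuclideanSpace ℝ (Fin d))
    have h2 := ((hφ.1.differentiable (by simp))
      (r • (σ : EuclideanSpace ℝ (Fin d)))).hasFDerivAt.comp_hasDerivAt r h1
    have h3 : deriv g r = fderiv ℝ φ (r • (σ : EuclideanSpace ℝ (Fin d))) σ := h2.deriv
    rw [h3, gradient, LinearIsometryEquiv.norm_map]
    simpa [hnorm] using (fderiv ℝ φ (r • (σ : EuclideanSpace ℝ (Fin d)))).le_opNorm σ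
  have hgs : ∀ r, 0 < r → g r ≠ 0 → δ ≤ r ∧ r ≤ R := by
    intro r hr h
    simpa [norm_smul_sphere σ hr] using hsupp _ (subset_tsupport φ h)
  have h := interpolation_ray hd hgd hδ hgs hp2 hp3 hθ hθ1 ha hb
  refine le_trans (le_of_eq ?_) (h.trans ?_)
  · rw [rayMass]
    congr 1
    refine setLIntegral_congr_fun measurableSet_Ioi fun r hr => ?_
    simp only [norm_smul_sphere σ hr, hg]
  · gcongr ?_ * (?_ ^ θ * ?_ ^ (1 - θ))
    · exact le_rfl
    · refine setLIntegral_mono' measurableSet_Ioi fun r hr => ?_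
      rw [norm_smul_sphere σ hr]
      have hr' : (0 : ℝ) ≤ r := le_of_lt hr
      gcongr
      exact hg' r
    · refine le_of_eq (setLIntegral_congr_fun measurableSet_Ioi fun r hr => ?_)
      simp only [norm_smul_sphere σ hr, hg]

/-- Minkowski's inequality for weighted `L²` norms. -/
lemma rpow_half_lintegral_le_add {V : Type*} [NormedAddCommGroup V]
    {F H : EuclideanSpace ℝ (Fin d) → V} (hF : AEStronglyMeasurable F volume)
    (hH : AEStronglyMeasurable H volume) (c : ℝ) :
    (∫⁻ x, ENNReal.ofReal (‖F x‖ ^ 2 * ‖x‖ ^ c)) ^ (1 / 2 : ℝ) ≤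
      (∫⁻ x, ENNReal.ofReal (‖F x - H x‖ ^ 2 * ‖x‖ ^ c)) ^ (1 / 2 : ℝ) +
        (∫⁻ x, ENNReal.ofReal (‖H x‖ ^ 2 * ‖x‖ ^ c)) ^ (1 / 2 : ℝ) := by
  have key : ∀ W : EuclideanSpace ℝ (Fin d) → V, ∀ x, ENNReal.ofReal (‖W x‖ ^ 2 * ‖x‖ ^ c) =
      (ENNReal.ofReal (‖W x‖ * ‖x‖ ^ (c / 2))) ^ (2 : ℝ) := by
    intro W x
    rw [ENNReal.ofReal_rpow_of_nonneg (by positivity) (by norm_num),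
      Real.mul_rpow (by positivity) (by positivity), ← Real.rpow_mul (norm_nonneg _)]
    norm_num
  have e1 := key F
  have e2 := key H
  have e3 := key (fun x => F x - H x)
  simp_rw [e1, e2, e3]
  have m : Measurable fun x : EuclideanSpace ℝ (Fin d) => ‖x‖ ^ (c / 2) := by fun_prop
  refine le_trans ?_ (ENNReal.lintegral_Lp_add_le
    (((hF.sub hH).norm.aemeasurable.mul m.aemeasurable).ennreal_ofReal)
    ((hH.norm.aemeasurable.mul m.aemeasurable).ennreal_ofReal) (p := 2) (by norm_num))
  gcongr with x
  simp only [Pi.add_apply]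
  rw [← ENNReal.ofReal_add (by positivity) (by positivity), ← add_mul]
  gcongr
  calc ‖F x‖ = ‖(F x - H x) + H x‖ := by rw [sub_add_cancel]
    _ ≤ _ := norm_add_le _ _

lemma tendsto_lintegral_of_tendsto_sub {V : Type*} [NormedAddCommGroup V]
    {F : ℕ → EuclideanSpace ℝ (Fin d) → V} {H : EuclideanSpace ℝ (Fin d) → V}
    (hF : ∀ n, AEStronglyMeasurable (F n) volume)
    (hH : AEStronglyMeasurable H volume) (c : ℝ)
    (hfin : ∀ n, ∫⁻ x, ENNReal.ofReal (‖F n x‖ ^ 2 * ‖x‖ ^ c) ≠ ⊤)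
    (h : Tendsto (fun n => ∫⁻ x, ENNReal.ofReal (‖F n x - H x‖ ^ 2 * ‖x‖ ^ c)) atTop (𝓝 0)) :
    ∫⁻ x, ENNReal.ofReal (‖H x‖ ^ 2 * ‖x‖ ^ c) ≠ ⊤ ∧
    Tendsto (fun n => ∫⁻ x, ENNReal.ofReal (‖F n x‖ ^ 2 * ‖x‖ ^ c)) atTop
      (𝓝 (∫⁻ x, ENNReal.ofReal (‖H x‖ ^ 2 * ‖x‖ ^ c))) := by
  set N : (EuclideanSpace ℝ (Fin d) → V) → ℝ≥0∞ := fun W =>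
    (∫⁻ x, ENNReal.ofReal (‖W x‖ ^ 2 * ‖x‖ ^ c)) ^ (1 / 2 : ℝ) with hN
  have hN2 : ∀ W, (N W) ^ (2 : ℝ) = ∫⁻ x, ENNReal.ofReal (‖W x‖ ^ 2 * ‖x‖ ^ c) := by
    intro W
    rw [hN, ← ENNReal.rpow_mul]
    norm_num
  have he : Tendsto (fun n => N (fun x => F n x - H x)) atTop (𝓝 0) := by
    have := h.ennrpow_const (1 / 2 : ℝ)
    rwa [ENNReal.zero_rpow_of_pos (by norm_num)] at this
  have h1 : ∀ n, N (F n) ≤ N (fun x => F n x - H x) + N H := fun n =>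
    rpow_half_lintegral_le_add (hF n) hH c
  have h2 : ∀ n, N H ≤ N (fun x => F n x - H x) + N (F n) := by
    intro n
    have := rpow_half_lintegral_le_add hH (hF n) c
    simpa only [norm_sub_rev] using this
  have hfinN : ∀ n, N (F n) ≠ ⊤ := fun n => ENNReal.rpow_ne_top_of_nonneg (by norm_num) (hfin n)
  have hH' : N H ≠ ⊤ := by
    obtain ⟨n, hn⟩ := (he.eventually (gt_mem_nhds zero_lt_one)).exists
    exact ne_top_of_le_ne_top (ENNReal.add_ne_top.2 ⟨(hn.trans ENNReal.one_lt_top).ne, hfinN n⟩)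
      (h2 n)
  have ht : Tendsto (fun n => N (F n)) atTop (𝓝 (N H)) := by
    refine tendsto_of_tendsto_of_tendsto_of_le_of_le (g := fun n => N H - N (fun x => F n x - H x))
      (h := fun n => N (fun x => F n x - H x) + N H) ?_ ?_ (fun n => ?_) h1
    · simpa using ENNReal.Tendsto.sub (tendsto_const_nhds (x := N H)) he (Or.inl hH')
    · simpa using he.add (tendsto_const_nhds (x := N H))
    · exact tsub_le_iff_left.2 (h2 n)
  have ht2 := ht.ennrpow_const (2 : ℝ)
  simp_rw [hN2] at ht2
  refine ⟨?_, ht2⟩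
  rw [← hN2]
  exact ENNReal.rpow_ne_top_of_nonneg (by norm_num) hH'

lemma lintegral_ofReal_ne_top_of_annulus {f : EuclideanSpace ℝ (Fin d) → ℝ} {c δ R : ℝ}
    (hf : Continuous f) (hδ : 0 < δ) (hsupp : ∀ x, f x ≠ 0 → δ ≤ ‖x‖ ∧ ‖x‖ ≤ R) :
    ∫⁻ x, ENNReal.ofReal (f x * ‖x‖ ^ c) ≠ ⊤ := by
  have hcont : Continuous fun x => f x * (max δ ‖x‖) ^ c := by
    refine hf.mul (Continuous.rpow_const (by fun_prop) fun x => Or.inl ?_)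
    exact (hδ.trans_le (le_max_left _ _)).ne'
  have hcs : HasCompactSupport fun x => f x * (max δ ‖x‖) ^ c := by
    refine HasCompactSupport.of_support_subset_isCompact
      (isCompact_closedBall (0 : EuclideanSpace ℝ (Fin d)) R) fun x hx => ?_
    simpa using (hsupp x (left_ne_zero_of_mul hx)).2
  have hi := (hcont.integrable_of_hasCompactSupport hcs).lintegral_lt_top (μ := volume)
  refine ne_of_lt (lt_of_le_of_lt (le_of_eq ?_) hi)
  refine lintegral_congr fun x => ?_
  by_cases hx : f x = 0
  · simp [hx]
  · rw [max_eq_right (hsupp x hx).1]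

lemma IsTestFunction.gradEnergy_ne_top {φ : EuclideanSpace ℝ (Fin d) → ℝ}
    (hφ : IsTestFunction φ) (a : ℝ) : gradEnergy a (gradient φ) ≠ ⊤ := by
  obtain ⟨δ, R, hδ, hsupp⟩ := hφ.exists_annulus
  refine lintegral_ofReal_ne_top_of_annulus (f := fun x => ‖gradient φ x‖ ^ 2)
    (hφ.continuous_gradient.norm.pow 2) hδ fun x hx => hsupp x ?_
  by_contra hx'
  refine hx ?_
  have := Function.notMem_support.1 fun h => hx' (support_fderiv_subset ℝ h)
  simp [gradient, this]

lemma IsTestFunction.mass_ne_top {φ : EuclideanSpace ℝ (Fin d) → ℝ}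
    (hφ : IsTestFunction φ) (a : ℝ) : mass a φ ≠ ⊤ := by
  obtain ⟨δ, R, hδ, hsupp⟩ := hφ.exists_annulus
  refine lintegral_ofReal_ne_top_of_annulus (f := fun x => |φ x| ^ 2)
    (hφ.1.continuous.abs.pow 2) hδ fun x hx => hsupp x (subset_tsupport φ ?_)
  intro h
  simp [h] at hx

lemma exists_subseq_tendsto_ae_of_mass {a : ℝ} {u : EuclideanSpace ℝ (Fin d) → ℝ}
    {φ : ℕ → EuclideanSpace ℝ (Fin d) → ℝ} (hu : AEStronglyMeasurable u volume)
    (hφ : ∀ n, IsTestFunction (φ n)) (hd : 1 ≤ d)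
    (h : Tendsto (fun n => mass a (fun x => φ n x - u x)) atTop (𝓝 0)) :
    ∃ ns : ℕ → ℕ, StrictMono ns ∧ ∀ᵐ x, Tendsto (fun n => φ (ns n) x) atTop (𝓝 (u x)) := by
  have : NeZero d := ⟨by omega⟩
  have m : Measurable fun x : EuclideanSpace ℝ (Fin d) => ‖x‖ ^ (-(2 * (a + 1))) := by fun_prop
  have hm : ∀ n, AEStronglyMeasurable
      (fun x => |φ n x - u x| ^ 2 * ‖x‖ ^ (-(2 * (a + 1)))) volume := fun n =>
    (((hφ n).1.continuous.aestronglyMeasurable.sub hu).norm.pow 2).mul m.aestronglyMeasurable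
  have h1 : TendstoInMeasure volume (fun n x => |φ n x - u x| ^ 2 * ‖x‖ ^ (-(2 * (a + 1))))
      atTop (fun _ => (0 : ℝ)) := by
    refine tendstoInMeasure_of_tendsto_eLpNorm (p := 1) one_ne_zero hm
      aestronglyMeasurable_const ?_
    refine h.congr fun n => ?_
    rw [eLpNorm_one_eq_lintegral_enorm, mass]
    refine lintegral_congr fun x => ?_
    rw [Pi.sub_apply, sub_zero, Real.enorm_of_nonneg (by positivity)]
  obtain ⟨ns, hns, hae⟩ := h1.exists_seq_tendsto_ae
  refine ⟨ns, hns, ?_⟩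
  filter_upwards [hae, compl_mem_ae_iff.2 (measure_singleton (0 : EuclideanSpace ℝ (Fin d)))]
    with x hx hx0
  have hxpos : 0 < ‖x‖ := norm_pos_iff.2 hx0
  have h2 := (hx.mul_const (‖x‖ ^ (-(2 * (a + 1))))⁻¹).sqrt
  have hne : ‖x‖ ^ (-(2 * (a + 1))) ≠ 0 := (Real.rpow_pos_of_pos hxpos _).ne'
  simp only [mul_assoc, mul_inv_cancel₀ hne, mul_one, zero_mul, Real.sqrt_zero,
    Real.sqrt_sq (abs_nonneg _)] at h2
  exact tendsto_sub_nhds_zero_iff.1 ((tendsto_zero_iff_abs_tendsto_zero _).2 h2)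

/-- The interpolation inequality for the mixed norm passes to the closure of the test functions by
Fatou's lemma. -/
theorem MemD.lintegral_rayMass_le (hd : 1 ≤ d) {u : EuclideanSpace ℝ (Fin d) → ℝ}
    {G : EuclideanSpace ℝ (Fin d) → EuclideanSpace ℝ (Fin d)} {p θ a b : ℝ}
    (hu : MemD a u G) (hp2 : 2 < p)
    (hp3 : p ≤ 3) (hθ : (p - 2) / (2 * p) < θ) (hθ1 : θ < 1) (ha : a < aCrit d)
    (hb : p = pExp d a b) :
    gradEnergy a G ≠ ⊤ ∧ mass a u ≠ ⊤ ∧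
    ∫⁻ σ, rayMass b p u σ ^ (2 / p) ∂(volume : Measure (EuclideanSpace ℝ (Fin d))).toSphere ≤
      ENNReal.ofReal (rayConst p θ (aCrit d - a)) *
        (gradEnergy a G ^ θ * mass a u ^ (1 - θ)) := by
  have hp0 : 0 < p := by linarith
  have hθ0 : 0 < θ := by
    have : 0 < p - 2 := by linarith
    have : 0 < (p - 2) / (2 * p) := by positivity
    linarith
  obtain ⟨hum, hGm, φ, hφ, hM, hG⟩ := hu
  obtain ⟨hGfin, hGt⟩ := tendsto_lintegral_of_tendsto_sub
    (fun n => (hφ n).continuous_gradient.aestronglyMeasurable) hGm (-(2 * a))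
    (fun n => (hφ n).gradEnergy_ne_top a) hG
  obtain ⟨hMfin, hMt⟩ := tendsto_lintegral_of_tendsto_sub
    (fun n => (hφ n).1.continuous.aestronglyMeasurable) hum (-(2 * (a + 1)))
    (fun n => (hφ n).mass_ne_top a) hM
  refine ⟨hGfin, hMfin, ?_⟩
  obtain ⟨ns, hns, hae⟩ := exists_subseq_tendsto_ae_of_mass hum hφ hd hM
  have hlim : Tendsto (fun n => ENNReal.ofReal (rayConst p θ (aCrit d - a)) *
      (gradEnergy a (gradient (φ (ns n))) ^ θ * mass a (φ (ns n)) ^ (1 - θ))) atTop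
      (𝓝 (ENNReal.ofReal (rayConst p θ (aCrit d - a)) *
        (gradEnergy a G ^ θ * mass a u ^ (1 - θ)))) := by
    refine ENNReal.Tendsto.const_mul (ENNReal.Tendsto.mul
      ((hGt.comp hns.tendsto_atTop).ennrpow_const θ) (Or.inr ?_)
      ((hMt.comp hns.tendsto_atTop).ennrpow_const (1 - θ)) (Or.inr ?_))
      (Or.inr ENNReal.ofReal_ne_top)
    · exact ENNReal.rpow_ne_top_of_nonneg (by linarith) hMfin
    · exact ENNReal.rpow_ne_top_of_nonneg (by linarith) hGfin
  have hray : ∀ᵐ σ ∂(volume : Measure (EuclideanSpace ℝ (Fin d))).toSphere,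
      rayMass b p u σ ^ (2 / p) ≤ liminf (fun n => rayMass b p (φ (ns n)) σ ^ (2 / p)) atTop := by
    filter_upwards [ae_polar hd hae] with σ hσ
    have h1 : rayMass b p u σ ≤ liminf (fun n => rayMass b p (φ (ns n)) σ) atTop := by
      refine le_trans (lintegral_mono_ae ?_) (lintegral_liminf_le fun n => ?_)
      · filter_upwards [hσ] with r hr
        refine le_of_eq (Tendsto.liminf_eq ?_).symm
        refine ENNReal.Tendsto.mul_const ?_ (Or.inr ENNReal.ofReal_ne_top)
        exact ENNReal.tendsto_ofReal ((hr.abs.rpow_const (Or.inr hp0.le)).mul_const _)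
      · have : Measurable fun r : ℝ => r • (σ : EuclideanSpace ℝ (Fin d)) := by fun_prop
        exact ((measurable_pIntegrand (hφ (ns n)).1.continuous.measurable).comp this).mul
          (by fun_prop)
    calc rayMass b p u σ ^ (2 / p)
        ≤ (liminf (fun n => rayMass b p (φ (ns n)) σ) atTop) ^ (2 / p) := by gcongr
      _ = _ := (ENNReal.monotone_rpow_of_nonneg (by positivity)).map_liminf_of_continuousAt _
          (ENNReal.continuous_rpow_const.continuousAt)
  calc _ ≤ ∫⁻ σ, liminf (fun n => rayMass b p (φ (ns n)) σ ^ (2 / p)) atTop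
        ∂(volume : Measure (EuclideanSpace ℝ (Fin d))).toSphere := lintegral_mono_ae hray
    _ ≤ liminf (fun n => ∫⁻ σ, rayMass b p (φ (ns n)) σ ^ (2 / p)
        ∂(volume : Measure (EuclideanSpace ℝ (Fin d))).toSphere) atTop :=
      lintegral_liminf_le fun n => (measurable_rayIntegral
        (measurable_pIntegrand (hφ (ns n)).1.continuous.measurable)).pow_const _
    _ ≤ liminf (fun n => ENNReal.ofReal (rayConst p θ (aCrit d - a)) *
      (gradEnergy a (gradient (φ (ns n))) ^ θ * mass a (φ (ns n)) ^ (1 - θ))) atTop :=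
      liminf_le_liminf (.of_forall fun n =>
        CKN.lintegral_rayMass_le hd (hφ (ns n)) hp2 hp3 hθ hθ1 ha hb)
    _ = _ := hlim.liminf_eq

/-- An upper bound for the optimal constant among radial functions; its first factor is a power of
the area of the unit sphere. -/
noncomputable def radialConst (d : ℕ) (p θ a : ℝ) : ℝ :=
  ((volume : Measure (EuclideanSpace ℝ (Fin d))).toSphere.real Set.univ) ^ (2 / p - 1) *
    rayConst p θ (aCrit d - a)

/-- For radial functions the mixed norm and the full weighted `L^p` norm differ by a power of the
area of the unit sphere. -/
theorem MemD.pMass_le_of_isRadial (hd : 1 ≤ d) {u : EuclideanSpace ℝ (Fin d) → ℝ}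
    {G : EuclideanSpace ℝ (Fin d) → EuclideanSpace ℝ (Fin d)} {p θ a b : ℝ}
    (hu : MemD a u G) (hrad : IsRadial u) (hp2 : 2 < p)
    (hp3 : p ≤ 3) (hθ : (p - 2) / (2 * p) < θ) (hθ1 : θ < 1) (ha : a < aCrit d)
    (hb : p = pExp d a b) :
    pMass b p u ^ (2 / p) ≤ ENNReal.ofReal (radialConst d p θ a) *
      (gradEnergy a G ^ θ * mass a u ^ (1 - θ)) := by
  have hp0 : 0 < p := by linarith
  have : NeZero d := ⟨by omega⟩
  obtain ⟨-, -, h⟩ := hu.lintegral_rayMass_le hd hp2 hp3 hθ hθ1 ha hb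
  obtain ⟨f, hf⟩ := hrad
  set S := (volume : Measure (EuclideanSpace ℝ (Fin d))).toSphere Set.univ with hS
  have hS0 : S ≠ 0 := by
    rw [hS, Measure.measure_univ_ne_zero]
    exact Measure.toSphere_ne_zero _
  have hStop : S ≠ ⊤ := measure_ne_top _ _
  set P : ℝ≥0∞ := ∫⁻ r in Set.Ioi (0 : ℝ), ENNReal.ofReal (|f r| ^ p * r ^ (-(b * p))) *
    ENNReal.ofReal (r ^ (d - 1)) with hP
  have hray : ∀ᵐ σ ∂(volume : Measure (EuclideanSpace ℝ (Fin d))).toSphere,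
      rayMass b p u σ = P := by
    filter_upwards [ae_polar hd hf] with σ hσ
    refine lintegral_congr_ae ?_
    filter_upwards [hσ, ae_restrict_mem measurableSet_Ioi] with r hr hr0
    rw [hr, norm_smul_sphere σ hr0]
  have hpm : pMass b p u = P * S := by
    have hum := hu.1.aemeasurable
    have e : pMass b p u = pMass b p (hum.mk u) := by
      refine lintegral_congr_ae ?_
      filter_upwards [hum.ae_eq_mk] with x hx
      rw [← hx]
    have hray' : ∀ᵐ σ ∂(volume : Measure (EuclideanSpace ℝ (Fin d))).toSphere,
        rayMass b p (hum.mk u) σ = P := by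
      filter_upwards [ae_polar hd hum.ae_eq_mk, hray] with σ h1 h2
      rw [← h2]
      refine lintegral_congr_ae ?_
      filter_upwards [h1] with r hr
      rw [hr]
    rw [e, pMass, lintegral_polar hd (measurable_pIntegrand hum.measurable_mk)]
    calc _ = ∫⁻ _, P ∂(volume : Measure (EuclideanSpace ℝ (Fin d))).toSphere :=
          lintegral_congr_ae hray'
      _ = _ := lintegral_const _
  have hmix : ∫⁻ σ, rayMass b p u σ ^ (2 / p)
      ∂(volume : Measure (EuclideanSpace ℝ (Fin d))).toSphere = P ^ (2 / p) * S := by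
    rw [← lintegral_const]
    refine lintegral_congr_ae ?_
    filter_upwards [hray] with σ hσ
    rw [hσ]
  rw [hmix] at h
  have hSr : ENNReal.ofReal ((volume : Measure (EuclideanSpace ℝ (Fin d))).toSphere.real Set.univ
      ^ (2 / p - 1)) = S ^ (2 / p - 1) := by
    have hpos : 0 < (volume : Measure (EuclideanSpace ℝ (Fin d))).toSphere.real Set.univ :=
      ENNReal.toReal_pos hS0 hStop
    rw [← ENNReal.ofReal_rpow_of_pos hpos, measureReal_def, ENNReal.ofReal_toReal hStop]
  rw [radialConst, ENNReal.ofReal_mul (by positivity), hSr, mul_assoc]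
  calc pMass b p u ^ (2 / p) = S ^ (2 / p - 1) * (P ^ (2 / p) * S) := by
        rw [hpm, ENNReal.mul_rpow_of_nonneg _ _ (by positivity),
          ENNReal.rpow_sub _ _ hS0 hStop, ENNReal.rpow_one, ENNReal.div_eq_inv_mul]
        calc P ^ (2 / p) * S ^ (2 / p) = (S⁻¹ * S) * (P ^ (2 / p) * S ^ (2 / p)) := by
              rw [ENNReal.inv_mul_cancel hS0 hStop, one_mul]
          _ = _ := by ring
    _ ≤ _ := by gcongr

end CKN

/-! ### The area of the sphere -/

namespace CKN

/-- A quantitative form of `e ^ 2 ≤ ((n + 2) / n) ^ (n + 1)`, from the first two terms of the power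
series of `log ((1 + x) / (1 - x))` at `x = 1 / (n + 1)`. -/
lemma exp_two_mul_pow_le {n : ℝ} (hn : 0 < n) :
    Real.exp 2 * (1 + 2 / (3 * (n + 1) ^ 2)) ≤ ((n + 2) / n) ^ (n + 1) := by
  have h := Real.sum_range_le_log_div (x := 1 / (n + 1)) (by positivity)
    (by rw [div_lt_one (by linarith)]; linarith) 2
  have e : (1 + 1 / (n + 1)) / (1 - 1 / (n + 1)) = (n + 2) / n := by
    have : 1 - 1 / (n + 1) = n / (n + 1) := by field_simp; ring
    rw [this]
    field_simp
    ring
  rw [e] at h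
  simp only [Finset.sum_range_succ, Finset.range_zero, Finset.sum_empty] at h
  have h2 : 2 + 2 / (3 * (n + 1) ^ 2) ≤ Real.log ((n + 2) / n) * (n + 1) := by
    have h3 := mul_le_mul_of_nonneg_right h (show 0 ≤ 2 * (n + 1) by linarith)
    refine le_trans (le_of_eq ?_) (h3.trans (le_of_eq ?_))
    · norm_num
      field_simp
    · ring
  rw [Real.rpow_def_of_pos (by positivity)]
  refine le_trans ?_ (Real.exp_le_exp.2 h2)
  rw [Real.exp_add]
  gcongr
  linarith [Real.add_one_le_exp (2 / (3 * (n + 1) ^ 2))]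

/-- A Stirling-type bound. The factor `n / (n + 6 / 25)` makes an induction in steps of two
possible; the constant `27 / 4` exceeds the limit `2 π` only slightly. -/
lemma sq_Gamma_le (n : ℕ) : Real.Gamma (((n : ℝ) + 1 + 1) / 2) ^ 2 ≤
    27 / 4 * (((n : ℝ) + 1) / ((n : ℝ) + 1 + 6 / 25)) *
      (((n : ℝ) + 1) / (2 * Real.exp 1)) ^ ((n : ℝ) + 1) := by
  induction n using Nat.twoStepInduction with
  | zero =>
    have := Real.exp_one_lt_d9
    norm_num
    field_simp
    linarith
  | one =>
    have h1 : Real.Gamma (3 / 2) ^ 2 = Real.pi / 4 := by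
      rw [show (3 / 2 : ℝ) = 1 / 2 + 1 by norm_num, Real.Gamma_add_one (by norm_num),
        Real.Gamma_one_half_eq, mul_pow, Real.sq_sqrt Real.pi_pos.le]
      ring
    have e2 : (((1 : ℕ) : ℝ) + 1) = 2 := by norm_num
    have e3 : (2 / (2 * Real.exp 1)) ^ (2 : ℝ) = (Real.exp 1 ^ 2)⁻¹ := by
      rw [Real.rpow_ofNat, mul_comm, div_mul_cancel_right₀ two_ne_zero, inv_pow]
    rw [e2, show ((2 : ℝ) + 1) / 2 = 3 / 2 by norm_num, h1, e3]
    have hpi := Real.pi_lt_d2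
    have he := Real.exp_one_lt_d9
    have he0 := Real.exp_pos 1
    have h3 : Real.exp 1 ^ 2 ≤ 7.4 := by nlinarith
    have h4 : Real.pi * Real.exp 1 ^ 2 ≤ 3.15 * 7.4 := by gcongr
    rw [← div_eq_mul_inv, le_div_iff₀ (by positivity)]
    norm_num at h4 ⊢
    linarith
  | more n ih _ =>
    set m : ℝ := (n : ℝ) + 1 with hm
    have hm1 : 1 ≤ m := by rw [hm]; linarith [n.cast_nonneg (α := ℝ)]
    have hm0 : 0 < m := by linarith
    have e : ((n + 2 : ℕ) : ℝ) + 1 = m + 2 := by push_cast; ring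
    rw [e, show (m + 2 + 1) / 2 = (m + 1) / 2 + 1 by ring, Real.Gamma_add_one (by positivity),
      mul_pow]
    have hB := exp_two_mul_pow_le hm0
    have hE : 0 < Real.exp 1 := Real.exp_pos _
    have hE2 : Real.exp 2 = Real.exp 1 ^ 2 := by rw [← Real.exp_nat_mul]; norm_num
    have hm2 : 0 < m ^ m := by positivity
    have key : ((m + 1) / 2) ^ 2 * (m / (m + 6 / 25)) * (m / (2 * Real.exp 1)) ^ m ≤
        ((m + 2) / (m + 2 + 6 / 25)) * ((m + 2) / (2 * Real.exp 1)) ^ (m + 2) := by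
      have hpoly : 3 * (m + 1) ^ 4 * (m + 2 + 6 / 25) ≤
          (3 * (m + 1) ^ 2 + 2) * (m + 2) ^ 2 * (m + 6 / 25) := by
        have ht : 0 ≤ m - 1 := by linarith
        nlinarith [pow_nonneg ht 2, pow_nonneg ht 3, pow_nonneg ht 4]
      have hpow : m / (2 * Real.exp 1) = (m / (m + 2)) * ((m + 2) / (2 * Real.exp 1)) := by
        field_simp
      have hQ : 0 < ((m + 2) / (2 * Real.exp 1)) ^ m := by positivity
      rw [hpow, Real.mul_rpow (by positivity) (by positivity),
        Real.rpow_add (by positivity) m 2, Real.rpow_ofNat]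
      have hR : (m / (m + 2)) ^ m ≤ (m + 2) / m / (Real.exp 2 * (1 + 2 / (3 * (m + 1) ^ 2))) := by
        rw [Real.rpow_add (by positivity), Real.rpow_one] at hB
        have hinv : (m / (m + 2)) ^ m = (((m + 2) / m) ^ m)⁻¹ := by
          rw [← Real.inv_rpow (by positivity), inv_div]
        rw [hinv, le_div_iff₀ (by positivity), inv_mul_le_iff₀ (by positivity)]
        exact hB
      calc ((m + 1) / 2) ^ 2 * (m / (m + 6 / 25)) *
            ((m / (m + 2)) ^ m * ((m + 2) / (2 * Real.exp 1)) ^ m)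
          ≤ ((m + 1) / 2) ^ 2 * (m / (m + 6 / 25)) *
            (((m + 2) / m / (Real.exp 2 * (1 + 2 / (3 * (m + 1) ^ 2)))) *
              ((m + 2) / (2 * Real.exp 1)) ^ m) := by gcongr
        _ = (3 * (m + 1) ^ 4 * (m + 2 + 6 / 25)) * ((m + 2) /
              (4 * Real.exp 2 * (3 * (m + 1) ^ 2 + 2) * (m + 6 / 25) * (m + 2 + 6 / 25)) *
              ((m + 2) / (2 * Real.exp 1)) ^ m) := by field_simp; norm_num
        _ ≤ ((3 * (m + 1) ^ 2 + 2) * (m + 2) ^ 2 * (m + 6 / 25)) * ((m + 2) /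
              (4 * Real.exp 2 * (3 * (m + 1) ^ 2 + 2) * (m + 6 / 25) * (m + 2 + 6 / 25)) *
              ((m + 2) / (2 * Real.exp 1)) ^ m) := by gcongr
        _ = _ := by
          rw [hE2]; field_simp; ring
    calc ((m + 1) / 2) ^ 2 * Real.Gamma ((m + 1) / 2) ^ 2
        ≤ ((m + 1) / 2) ^ 2 * (27 / 4 * (m / (m + 6 / 25)) * (m / (2 * Real.exp 1)) ^ m) := by
          gcongr
      _ = 27 / 4 * (((m + 1) / 2) ^ 2 * (m / (m + 6 / 25)) * (m / (2 * Real.exp 1)) ^ m) := by ring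
      _ ≤ 27 / 4 * (((m + 2) / (m + 2 + 6 / 25)) * ((m + 2) / (2 * Real.exp 1)) ^ (m + 2)) := by
          gcongr
      _ = _ := by ring

lemma sq_toSphere_univ {d : ℕ} (hd : 1 ≤ d) :
    (volume : Measure (EuclideanSpace ℝ (Fin d))).toSphere.real Set.univ ^ 2 =
      4 * Real.pi ^ (d : ℝ) / Real.Gamma ((d : ℝ) / 2) ^ 2 := by
  have : NeZero d := ⟨by omega⟩
  have hd0 : (0 : ℝ) < d := by exact_mod_cast hd
  have hG : 0 < Real.Gamma ((d : ℝ) / 2) := Real.Gamma_pos_of_pos (by positivity)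
  rw [Measure.toSphere_real_apply_univ, measureReal_def, EuclideanSpace.volume_ball,
    finrank_euclideanSpace_fin, Fintype.card_fin, ENNReal.ofReal_one, one_pow, one_mul,
    Real.Gamma_add_one (by positivity), ENNReal.toReal_ofReal (by positivity)]
  have h1 : (√Real.pi ^ d) ^ 2 = Real.pi ^ (d : ℝ) := by
    rw [← pow_mul, mul_comm, pow_mul, Real.sq_sqrt Real.pi_pos.le, Real.rpow_natCast]
  rw [mul_pow, div_pow, h1]
  field_simp
  norm_num

/-- The numerical inequality which decides the comparison between radial functions and
concentrating Gaussians in the limit `p → 2`. -/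
lemma pi_exp_rpow_lt {d : ℕ} (hd : 2 ≤ d) :
    (Real.pi * Real.exp 1 / 2) ^ (d : ℝ) <
      (volume : Measure (EuclideanSpace ℝ (Fin d))).toSphere.real Set.univ ^ 2 *
        (27 / 32 * Real.exp 1) * (((d : ℝ) - 1) / 4) ^ ((d : ℝ) - 1) := by
  obtain ⟨n, rfl⟩ : ∃ n, d = n + 2 := ⟨d - 2, by omega⟩
  rw [sq_toSphere_univ (by omega)]
  have h := sq_Gamma_le n
  have e1 : ((n + 2 : ℕ) : ℝ) = (n : ℝ) + 1 + 1 := by push_cast; ring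
  rw [e1, add_sub_cancel_right]
  set m : ℝ := (n : ℝ) + 1 with hm
  have hm0 : 0 < m := by positivity
  have hE : 0 < Real.exp 1 := Real.exp_pos _
  have hpi := Real.pi_pos
  have hG : 0 < Real.Gamma ((m + 1) / 2) := Real.Gamma_pos_of_pos (by positivity)
  have h2 : Real.Gamma ((m + 1) / 2) ^ 2 < 27 / 4 * (m / (2 * Real.exp 1)) ^ m := by
    refine h.trans_lt ?_
    have hlt : m / (m + 6 / 25) < 1 := by rw [div_lt_one (by positivity)]; linarith
    have hpos : 0 < (m / (2 * Real.exp 1)) ^ m := by positivity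
    nlinarith
  have e2 : (Real.pi * Real.exp 1 / 2) ^ (m + 1) =
      Real.pi ^ (m + 1) * (Real.exp 1 / 2) * (Real.exp 1 / 2) ^ m := by
    rw [mul_div_assoc, Real.mul_rpow hpi.le (by positivity),
      Real.rpow_add (show 0 < Real.exp 1 / 2 by positivity), Real.rpow_one]
    ring
  have e3 : (m / 4) ^ m = (m / (2 * Real.exp 1)) ^ m * (Real.exp 1 / 2) ^ m := by
    rw [← Real.mul_rpow (by positivity) (by positivity)]
    congr 1
    field_simp
    norm_num
  rw [e2, e3, div_mul_eq_mul_div, div_mul_eq_mul_div, lt_div_iff₀ (by positivity)]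
  have hpos : 0 < Real.pi ^ (m + 1) * (Real.exp 1 / 2) * (Real.exp 1 / 2) ^ m := by positivity
  calc _ < Real.pi ^ (m + 1) * (Real.exp 1 / 2) * (Real.exp 1 / 2) ^ m *
        (27 / 4 * (m / (2 * Real.exp 1)) ^ m) := by gcongr
    _ = _ := by ring

end CKN

/-! ### Concentrating Gaussians -/

namespace CKN

variable {d : ℕ}

lemma integrable_exp_neg_mul_sq_norm {b : ℝ} (hb : 0 < b) :
    Integrable fun z : EuclideanSpace ℝ (Fin d) => Real.exp (-b * ‖z‖ ^ 2) := by
  refine Integrable.of_integral_ne_zero ?_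
  rw [GaussianFourier.integral_rexp_neg_mul_sq_norm hb]
  positivity

lemma sq_mul_exp_neg_sq_le (r : ℝ) : r ^ 2 * Real.exp (-1 * r ^ 2) ≤
    2 * Real.exp (-(1 / 2) * r ^ 2) := by
  have h : r ^ 2 ≤ 2 * Real.exp (1 / 2 * r ^ 2) := by
    linarith [Real.add_one_le_exp (1 / 2 * r ^ 2)]
  calc r ^ 2 * Real.exp (-1 * r ^ 2) ≤
        2 * Real.exp (1 / 2 * r ^ 2) * Real.exp (-1 * r ^ 2) := by gcongr
    _ = _ := by rw [mul_assoc, ← Real.exp_add]; ring_nf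

lemma integrable_sq_norm_mul_exp :
    Integrable fun z : EuclideanSpace ℝ (Fin d) => ‖z‖ ^ 2 * Real.exp (-1 * ‖z‖ ^ 2) := by
  refine ((integrable_exp_neg_mul_sq_norm (d := d) (b := 1 / 2) (by norm_num)).const_mul 2).mono'
    (by fun_prop) (.of_forall fun z => ?_)
  rw [Real.norm_of_nonneg (by positivity)]
  exact sq_mul_exp_neg_sq_le _

lemma integral_sq_norm_mul_exp (hd : 1 ≤ d) :
    ∫ z : EuclideanSpace ℝ (Fin d), ‖z‖ ^ 2 * Real.exp (-1 * ‖z‖ ^ 2) =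
      (d : ℝ) / 2 * Real.pi ^ ((d : ℝ) / 2) := by
  have : NeZero d := ⟨by omega⟩
  have hd0 : (0 : ℝ) < d := by exact_mod_cast hd
  have h0 : ∫ z : EuclideanSpace ℝ (Fin d), Real.exp (-1 * ‖z‖ ^ 2) =
      Real.pi ^ ((d : ℝ) / 2) := by
    rw [GaussianFourier.integral_rexp_neg_mul_sq_norm one_pos, div_one, finrank_euclideanSpace_fin]
  rw [← h0, integral_fun_norm_addHaar volume (fun r => r ^ 2 * Real.exp (-1 * r ^ 2)),
    integral_fun_norm_addHaar volume (fun r => Real.exp (-1 * r ^ 2)), finrank_euclideanSpace_fin]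
  have g : ∀ q : ℕ, ∫ y in Set.Ioi (0 : ℝ), y ^ q * Real.exp (-1 * y ^ 2) =
      1 / 2 * Real.Gamma (((q : ℝ) + 1) / 2) := by
    intro q
    have h := integral_rpow_mul_exp_neg_mul_rpow (p := 2) (q := q) (b := 1) two_pos
      (by linarith [q.cast_nonneg (α := ℝ)]) one_pos
    rw [Real.one_rpow, one_mul] at h
    rw [← h]
    refine setIntegral_congr_fun measurableSet_Ioi fun y _ => ?_
    simp
  have e1 : ∀ y : ℝ, y ^ (d - 1) • (y ^ 2 * Real.exp (-1 * y ^ 2)) =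
      y ^ (d + 1) * Real.exp (-1 * y ^ 2) := by
    intro y
    rw [smul_eq_mul, ← mul_assoc, ← pow_add]
    congr 2
    omega
  simp_rw [e1, smul_eq_mul]
  rw [g, g]
  have e2 : (((d + 1 : ℕ) : ℝ) + 1) / 2 = (d : ℝ) / 2 + 1 := by push_cast; ring
  have e3 : (((d - 1 : ℕ) : ℝ) + 1) / 2 = (d : ℝ) / 2 := by rw [Nat.cast_sub hd]; push_cast; ring
  rw [e2, e3, Real.Gamma_add_one (by positivity)]
  simp only [nsmul_eq_mul]
  ring

lemma lintegral_comp_add_smul (e : EuclideanSpace ℝ (Fin d)) {N : ℝ} (hN : 0 < N)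
    {f : EuclideanSpace ℝ (Fin d) → ℝ≥0∞} (hf : Measurable f) :
    ∫⁻ z, f (e + N⁻¹ • z) = ENNReal.ofReal (N ^ d) * ∫⁻ x, f x := by
  have h := Measure.map_addHaar_smul (volume : Measure (EuclideanSpace ℝ (Fin d)))
    (inv_ne_zero hN.ne')
  rw [finrank_euclideanSpace_fin, inv_pow, inv_inv, abs_of_pos (by positivity)] at h
  have hm : Measurable fun y : EuclideanSpace ℝ (Fin d) => f (e + y) :=
    hf.comp (measurable_const_add e)
  rw [← lintegral_add_left_eq_self (μ := volume) f e, ← smul_eq_mul, ← lintegral_smul_measure, ← h,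
    lintegral_map hm (by fun_prop)]

lemma rpow_le_two_rpow_abs {r c : ℝ} (h1 : 1 / 2 ≤ r) (h2 : r ≤ 2) : r ^ c ≤ 2 ^ |c| := by
  have hr : 0 < r := by linarith
  rcases le_total 0 c with hc | hc
  · rw [abs_of_nonneg hc]
    gcongr
  · rw [abs_of_nonpos hc]
    calc r ^ c ≤ (1 / 2) ^ c := Real.rpow_le_rpow_of_nonpos (by norm_num) h1 hc
      _ = 2 ^ (-c) := by
        rw [one_div, Real.inv_rpow two_pos.le, Real.rpow_neg two_pos.le]

lemma tendsto_add_inv_smul (e z : EuclideanSpace ℝ (Fin d)) :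
    Tendsto (fun n : ℕ => e + ((n : ℝ) + 1)⁻¹ • z) atTop (𝓝 e) := by
  have h := (tendsto_one_div_add_atTop_nhds_zero_nat (𝕜 := ℝ)).smul_const z
  simpa using h.const_add e

/-- Under concentration at a unit vector `e`, all weights become one. -/
lemma tendsto_lintegral_concentrating {e : EuclideanSpace ℝ (Fin d)} (he : ‖e‖ = 1) (c : ℝ)
    {F : ℕ → EuclideanSpace ℝ (Fin d) → ℝ} {B f : EuclideanSpace ℝ (Fin d) → ℝ}
    (hF : ∀ n, Measurable (F n)) (hF0 : ∀ n z, 0 ≤ F n z) (hFB : ∀ n z, F n z ≤ B z)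
    (hsupp : ∀ (n : ℕ) z, F n z ≠ 0 →
      1 / 2 ≤ ‖e + ((n : ℝ) + 1)⁻¹ • z‖ ∧ ‖e + ((n : ℝ) + 1)⁻¹ • z‖ ≤ 2)
    (hlim : ∀ z, Tendsto (fun n => F n z) atTop (𝓝 (f z))) (hB : Integrable B) :
    Tendsto (fun n : ℕ => ∫⁻ z, ENNReal.ofReal (F n z * ‖e + ((n : ℝ) + 1)⁻¹ • z‖ ^ c)) atTop
      (𝓝 (∫⁻ z, ENNReal.ofReal (f z))) := by
  refine tendsto_lintegral_of_dominated_convergence' (fun z => ENNReal.ofReal (B z * 2 ^ |c|))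
    (fun n => ?_) (fun n => .of_forall fun z => ?_) ?_ (.of_forall fun z => ?_)
  · have : Measurable fun z : EuclideanSpace ℝ (Fin d) => ‖e + ((n : ℝ) + 1)⁻¹ • z‖ ^ c := by
      fun_prop
    exact ((hF n).mul this).ennreal_ofReal.aemeasurable
  · refine ENNReal.ofReal_le_ofReal ?_
    by_cases h : F n z = 0
    · rw [h, zero_mul]
      have := (hF0 n z).trans (hFB n z)
      positivity
    · have := (hF0 n z).trans (hFB n z)
      gcongr
      · exact hFB n z
      · exact rpow_le_two_rpow_abs (hsupp n z h).1 (hsupp n z h).2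
  · exact (hB.mul_const _).lintegral_lt_top.ne
  · refine ENNReal.tendsto_ofReal ?_
    have h1 := (tendsto_add_inv_smul e z).norm.rpow_const (p := c) (Or.inl (by simp [he]))
    simpa [he] using (hlim z).mul h1

/-- A Gaussian of width `N⁻¹` centred at `e` and truncated by the bump function `χ`. -/
noncomputable def bumpGaussian {e : EuclideanSpace ℝ (Fin d)} (χ : ContDiffBump e) (N : ℝ)
    (x : EuclideanSpace ℝ (Fin d)) : ℝ :=
  χ x * Real.exp (-(1 / 2) * N ^ 2 * ‖x - e‖ ^ 2)

lemma support_annulus {e : EuclideanSpace ℝ (Fin d)} (he : ‖e‖ = 1) {x : EuclideanSpace ℝ (Fin d)}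
    (hx : dist x e ≤ 1 / 2) : 1 / 2 ≤ ‖x‖ ∧ ‖x‖ ≤ 2 := by
  rw [dist_eq_norm] at hx
  have h1 := abs_norm_sub_norm_le x e
  rw [he] at h1
  obtain ⟨h2, h3⟩ := abs_le.1 (h1.trans hx)
  constructor <;> linarith

section

variable {e : EuclideanSpace ℝ (Fin d)} (χ : ContDiffBump e) (N : ℝ)

lemma tsupport_bumpGaussian_subset :
    tsupport (bumpGaussian χ N) ⊆ Metric.closedBall e χ.rOut := by
  rw [← χ.tsupport_eq]
  exact tsupport_mul_subset_left

lemma isTestFunction_bumpGaussian (he : ‖e‖ = 1) (hχ : χ.rOut = 1 / 2) :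
    IsTestFunction (bumpGaussian χ N) := by
  refine ⟨?_, ?_, fun h => ?_⟩
  · unfold bumpGaussian
    have h1 : ContDiff ℝ ∞ χ := χ.contDiff
    have h2 : ContDiff ℝ ∞ fun x : EuclideanSpace ℝ (Fin d) => ‖x - e‖ ^ 2 :=
      (contDiff_id.sub contDiff_const).norm_sq ℝ
    exact h1.mul (contDiff_const.mul h2).exp
  · exact χ.hasCompactSupport.mul_right
  · have := tsupport_bumpGaussian_subset χ N h
    rw [Metric.mem_closedBall, hχ] at this
    have := (support_annulus he this).1
    norm_num at this

lemma bumpGaussian_comp {N : ℝ} (hN : 0 < N) (z : EuclideanSpace ℝ (Fin d)) :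
    bumpGaussian χ N (e + N⁻¹ • z) =
      χ (e + N⁻¹ • z) * Real.exp (-(1 / 2) * ‖z‖ ^ 2) := by
  rw [bumpGaussian, add_sub_cancel_left, norm_smul, mul_pow, norm_inv, Real.norm_of_nonneg hN.le]
  congr 2
  field_simp

lemma gradient_bumpGaussian (x : EuclideanSpace ℝ (Fin d)) :
    gradient (bumpGaussian χ N) x = Real.exp (-(1 / 2) * N ^ 2 * ‖x - e‖ ^ 2) •
      (gradient χ x - (N ^ 2 * χ x) • (x - e)) := by
  have h1 : HasFDerivAt χ (fderiv ℝ χ x) x :=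
    ((χ.contDiff (n := 1)).differentiable one_ne_zero x).hasFDerivAt
  have h2 := ((((hasFDerivAt_id x).sub_const e).norm_sq).const_mul (-(1 / 2) * N ^ 2)).exp
  have h3 := (h1.mul h2).fderiv
  have h4 : fderiv ℝ (bumpGaussian χ N) x = _ := h3
  rw [gradient, h4, gradient]
  apply (InnerProductSpace.toDual ℝ (EuclideanSpace ℝ (Fin d))).injective
  rw [LinearIsometryEquiv.apply_symm_apply]
  ext v
  simp [InnerProductSpace.toDual_apply_apply]
  ring

lemma gradient_bumpGaussian_comp {N : ℝ} (hN : 0 < N) (z : EuclideanSpace ℝ (Fin d)) :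
    ‖gradient (bumpGaussian χ N) (e + N⁻¹ • z)‖ ^ 2 = N ^ 2 * (Real.exp (-1 * ‖z‖ ^ 2) *
      ‖N⁻¹ • gradient χ (e + N⁻¹ • z) - χ (e + N⁻¹ • z) • z‖ ^ 2) := by
  have e1 : gradient χ (e + N⁻¹ • z) - (N ^ 2 * χ (e + N⁻¹ • z)) • (N⁻¹ • z) =
      N • (N⁻¹ • gradient χ (e + N⁻¹ • z) - χ (e + N⁻¹ • z) • z) := by
    rw [smul_sub, smul_smul, smul_smul, smul_smul, mul_inv_cancel₀ hN.ne', one_smul]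
    congr 2
    field_simp
  rw [gradient_bumpGaussian, add_sub_cancel_left, e1, norm_smul, norm_smul, mul_pow, mul_pow,
    norm_smul, norm_inv, Real.norm_of_nonneg hN.le, Real.norm_of_nonneg (Real.exp_pos _).le,
    ← Real.exp_nat_mul]
  have : ((2 : ℕ) : ℝ) * (-(1 / 2) * N ^ 2 * (N⁻¹ ^ 2 * ‖z‖ ^ 2)) = -1 * ‖z‖ ^ 2 := by
    push_cast
    field_simp
  rw [this]
  ring

end

end CKN

namespace CKN

variable {d : ℕ}

section

variable {e : EuclideanSpace ℝ (Fin d)} (χ : ContDiffBump e)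

lemma tendsto_bump (z : EuclideanSpace ℝ (Fin d)) :
    Tendsto (fun n : ℕ => χ (e + ((n : ℝ) + 1)⁻¹ • z)) atTop (𝓝 1) := by
  have h := (χ.continuous.tendsto e).comp (tendsto_add_inv_smul e z)
  rwa [χ.one_of_mem_closedBall (Metric.mem_closedBall_self χ.rIn_pos.le)] at h

lemma annulus_of_mem_tsupport (he : ‖e‖ = 1) (hχ : χ.rOut = 1 / 2)
    {x : EuclideanSpace ℝ (Fin d)} (hx : x ∈ tsupport χ) : 1 / 2 ≤ ‖x‖ ∧ ‖x‖ ≤ 2 := by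
  rw [χ.tsupport_eq, Metric.mem_closedBall, hχ] at hx
  exact support_annulus he hx

lemma tendsto_pMass_bumpGaussian (he : ‖e‖ = 1) (hχ : χ.rOut = 1 / 2) {p : ℝ} (hp : 0 < p)
    (b : ℝ) :
    Tendsto (fun n : ℕ => ENNReal.ofReal (((n : ℝ) + 1) ^ d) *
      pMass b p (bumpGaussian χ ((n : ℝ) + 1))) atTop
      (𝓝 (ENNReal.ofReal ((2 * Real.pi / p) ^ ((d : ℝ) / 2)))) := by
  have hI := GaussianFourier.integral_rexp_neg_mul_sq_norm (V := EuclideanSpace ℝ (Fin d))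
    (b := p / 2) (by positivity)
  rw [finrank_euclideanSpace_fin, show Real.pi / (p / 2) = 2 * Real.pi / p by field_simp] at hI
  have hint := integrable_exp_neg_mul_sq_norm (d := d) (b := p / 2) (by positivity)
  rw [← hI, ofReal_integral_eq_lintegral_ofReal hint (.of_forall fun z => by positivity)]
  have hexp : ∀ z : EuclideanSpace ℝ (Fin d),
      Real.exp (-(1 / 2) * ‖z‖ ^ 2) ^ p = Real.exp (-(p / 2) * ‖z‖ ^ 2) := by
    intro z
    rw [← Real.exp_mul]
    ring_nf
  have hpow : ∀ (n : ℕ) (z : EuclideanSpace ℝ (Fin d)),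
      |bumpGaussian χ ((n : ℝ) + 1) (e + ((n : ℝ) + 1)⁻¹ • z)| ^ p =
        χ (e + ((n : ℝ) + 1)⁻¹ • z) ^ p * Real.exp (-(p / 2) * ‖z‖ ^ 2) := by
    intro n z
    rw [bumpGaussian_comp χ (by positivity), abs_of_nonneg (mul_nonneg χ.nonneg (by positivity)),
      Real.mul_rpow χ.nonneg (by positivity), hexp]
  have hT := tendsto_lintegral_concentrating he (-(b * p))
    (F := fun n z => χ (e + ((n : ℝ) + 1)⁻¹ • z) ^ p * Real.exp (-(p / 2) * ‖z‖ ^ 2))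
    (B := fun z => Real.exp (-(p / 2) * ‖z‖ ^ 2)) (f := fun z => Real.exp (-(p / 2) * ‖z‖ ^ 2))
    (fun n => ?_) (fun n z => ?_) (fun n z => ?_) (fun n z hz => ?_) (fun z => ?_) hint
  · refine hT.congr fun n => ?_
    have hφ := (isTestFunction_bumpGaussian χ ((n : ℝ) + 1) he hχ).1.continuous.measurable
    rw [pMass, ← lintegral_comp_add_smul e (by positivity) (measurable_pIntegrand hφ)]
    simp_rw [hpow]
  · have := χ.continuous.measurable
    fun_prop
  · have := χ.nonneg (x := e + ((n : ℝ) + 1)⁻¹ • z)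
    positivity
  · exact mul_le_of_le_one_left (by positivity) (Real.rpow_le_one χ.nonneg χ.le_one hp.le)
  · refine annulus_of_mem_tsupport χ he hχ (subset_tsupport _ fun h => hz ?_)
    simp only [h, Real.zero_rpow hp.ne', zero_mul]
  · have h := ((tendsto_bump χ z).rpow_const (p := p) (Or.inl one_ne_zero)).mul_const
      (Real.exp (-(p / 2) * ‖z‖ ^ 2))
    rwa [Real.one_rpow, one_mul] at h

lemma tendsto_mass_bumpGaussian (he : ‖e‖ = 1) (hχ : χ.rOut = 1 / 2) (a : ℝ) :
    Tendsto (fun n : ℕ => ENNReal.ofReal (((n : ℝ) + 1) ^ d) *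
      mass a (bumpGaussian χ ((n : ℝ) + 1))) atTop
      (𝓝 (ENNReal.ofReal (Real.pi ^ ((d : ℝ) / 2)))) := by
  have h := tendsto_pMass_bumpGaussian χ he hχ two_pos (a + 1)
  rw [mul_div_cancel_left₀ _ two_ne_zero] at h
  refine h.congr fun n => ?_
  simp only [pMass, mass, Real.rpow_ofNat, mul_comm]

lemma tendsto_gradEnergy_bumpGaussian (hd : 1 ≤ d) (he : ‖e‖ = 1) (hχ : χ.rOut = 1 / 2) (a : ℝ) :
    Tendsto (fun n : ℕ => ENNReal.ofReal (((n : ℝ) + 1) ^ d * (((n : ℝ) + 1) ^ 2)⁻¹) *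
      gradEnergy a (gradient (bumpGaussian χ ((n : ℝ) + 1)))) atTop
      (𝓝 (ENNReal.ofReal ((d : ℝ) / 2 * Real.pi ^ ((d : ℝ) / 2)))) := by
  have hgc : Continuous (gradient χ) :=
    (InnerProductSpace.toDual ℝ _).symm.continuous.comp
      ((χ.contDiff (n := 1)).continuous_fderiv one_ne_zero)
  have hgs : ∀ x, x ∉ tsupport χ → gradient χ x = 0 := by
    intro x hx
    have := Function.notMem_support.1 fun h => hx (support_fderiv_subset ℝ h)
    simp [gradient, this]
  obtain ⟨C, hC⟩ : ∃ C, ∀ x, ‖gradient χ x‖ ≤ C :=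
    hgc.bounded_above_of_compact_support
      (HasCompactSupport.intro χ.hasCompactSupport hgs)
  rw [← integral_sq_norm_mul_exp hd, ofReal_integral_eq_lintegral_ofReal
    integrable_sq_norm_mul_exp (.of_forall fun z => by positivity)]
  have hT := tendsto_lintegral_concentrating he (-(2 * a))
    (F := fun n z => Real.exp (-1 * ‖z‖ ^ 2) *
      ‖((n : ℝ) + 1)⁻¹ • gradient χ (e + ((n : ℝ) + 1)⁻¹ • z) -
        χ (e + ((n : ℝ) + 1)⁻¹ • z) • z‖ ^ 2)
    (B := fun z => 2 * C ^ 2 * Real.exp (-1 * ‖z‖ ^ 2) + 2 * (‖z‖ ^ 2 * Real.exp (-1 * ‖z‖ ^ 2)))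
    (f := fun z => ‖z‖ ^ 2 * Real.exp (-1 * ‖z‖ ^ 2))
    (fun n => ?_) (fun n z => by positivity) (fun n z => ?_) (fun n z hz => ?_) (fun z => ?_)
    (((integrable_exp_neg_mul_sq_norm one_pos).const_mul _).add
      (integrable_sq_norm_mul_exp.const_mul _))
  · refine hT.congr fun n => ?_
    have hN : (0 : ℝ) < (n : ℝ) + 1 := by positivity
    have hφ := (isTestFunction_bumpGaussian χ ((n : ℝ) + 1) he hχ).continuous_gradient.measurable
    have hm : Measurable fun x => ENNReal.ofReal
        (‖gradient (bumpGaussian χ ((n : ℝ) + 1)) x‖ ^ 2 * ‖x‖ ^ (-(2 * a))) := by fun_prop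
    rw [mul_comm (((n : ℝ) + 1) ^ d), ENNReal.ofReal_mul (by positivity), mul_assoc, gradEnergy,
      ← lintegral_comp_add_smul e hN hm]
    rw [← lintegral_const_mul' _ _ ENNReal.ofReal_ne_top]
    refine lintegral_congr fun z => ?_
    rw [← ENNReal.ofReal_mul (by positivity), gradient_bumpGaussian_comp χ hN]
    congr 1
    field_simp
  · have h1 := χ.continuous
    exact Continuous.measurable (by fun_prop)
  · have h1 : ‖((n : ℝ) + 1)⁻¹ • gradient χ (e + ((n : ℝ) + 1)⁻¹ • z) -
        χ (e + ((n : ℝ) + 1)⁻¹ • z) • z‖ ≤ C + ‖z‖ := by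
      refine (norm_sub_le _ _).trans (add_le_add ?_ ?_)
      · rw [norm_smul, Real.norm_of_nonneg (by positivity)]
        exact (mul_le_of_le_one_left (norm_nonneg _) (inv_le_one_of_one_le₀ (by
          linarith [n.cast_nonneg (α := ℝ)]))).trans (hC _)
      · rw [norm_smul, Real.norm_of_nonneg χ.nonneg]
        exact mul_le_of_le_one_left (norm_nonneg _) χ.le_one
    have h2 := pow_le_pow_left₀ (norm_nonneg _) h1 2
    have h3 : (C + ‖z‖) ^ 2 ≤ 2 * C ^ 2 + 2 * ‖z‖ ^ 2 := by nlinarith [sq_nonneg (C - ‖z‖)]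
    calc _ ≤ Real.exp (-1 * ‖z‖ ^ 2) * (2 * C ^ 2 + 2 * ‖z‖ ^ 2) := by
          gcongr
          exact h2.trans h3
      _ = _ := by ring
  · refine annulus_of_mem_tsupport χ he hχ ?_
    by_contra h
    refine hz ?_
    simp [hgs _ h, image_eq_zero_of_notMem_tsupport h]
  · have h1 : Tendsto (fun n : ℕ => ((n : ℝ) + 1)⁻¹ • gradient χ (e + ((n : ℝ) + 1)⁻¹ • z)) atTop
        (𝓝 ((0 : ℝ) • gradient χ e)) := by
      refine Tendsto.smul ?_ ((hgc.tendsto e).comp (tendsto_add_inv_smul e z))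
      simpa using tendsto_one_div_add_atTop_nhds_zero_nat (𝕜 := ℝ)
    have h2 := (((h1.sub ((tendsto_bump χ z).smul_const z)).norm.pow 2).const_mul
      (Real.exp (-1 * ‖z‖ ^ 2)))
    simpa [mul_comm] using h2

end

/-- In the limiting case `θ = ϑ(p, d)` the weighted quotient of concentrating Gaussians tends to
the quotient of the Gaussian in the Gagliardo-Nirenberg inequality without weights. -/
theorem exists_isTestFunction_quotient (hd : 1 ≤ d) {p K : ℝ} (a b : ℝ) (hp : 2 < p)
    (hK : K * (((d : ℝ) / 2) ^ vartheta p d * Real.pi ^ ((d : ℝ) / 2)) <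
      (2 * Real.pi / p) ^ ((d : ℝ) / p)) :
    ∃ φ : EuclideanSpace ℝ (Fin d) → ℝ, IsTestFunction φ ∧
      (∀ x ∈ tsupport φ, 1 / 2 ≤ ‖x‖ ∧ ‖x‖ ≤ 2) ∧ ∃ E Y A : ℝ, 0 < E ∧ 0 < Y ∧ 0 < A ∧
        gradEnergy a (gradient φ) ≤ ENNReal.ofReal E ∧ mass a φ ≤ ENNReal.ofReal Y ∧
        ENNReal.ofReal A ≤ pMass b p φ ∧
        K * (E ^ vartheta p d * Y ^ (1 - vartheta p d)) < A ^ (2 / p) := by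
  have hp0 : 0 < p := by linarith
  have hd0 : (0 : ℝ) < d := by exact_mod_cast hd
  have hpi := Real.pi_pos
  set ϑ := vartheta p d with hϑ
  have h2ϑ : 2 * ϑ - d = -(d * (2 / p)) := by rw [hϑ, vartheta]; field_simp; ring
  have : NeZero d := ⟨by omega⟩
  obtain ⟨e, he⟩ : ∃ e : EuclideanSpace ℝ (Fin d), ‖e‖ = 1 := exists_norm_eq _ zero_le_one
  let χ : ContDiffBump e := ⟨1 / 4, 1 / 2, by norm_num, by norm_num⟩
  set A := (2 * Real.pi / p) ^ ((d : ℝ) / 2) with hA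
  set B := (d : ℝ) / 2 * Real.pi ^ ((d : ℝ) / 2) with hB
  set C := Real.pi ^ ((d : ℝ) / 2) with hC
  have hA0 : 0 < A := by positivity
  have hB0 : 0 < B := by positivity
  have hC0 : 0 < C := by positivity
  -- room for perturbing the three limits
  obtain ⟨t, ht1, ht⟩ : ∃ t : ℝ, 1 < t ∧
      K * ((t * B) ^ ϑ * (t * C) ^ (1 - ϑ)) < (A / t) ^ (2 / p) := by
    have hc1 : ContinuousAt (fun t : ℝ => K * ((t * B) ^ ϑ * (t * C) ^ (1 - ϑ))) 1 := by
      refine continuousAt_const.mul (ContinuousAt.mul ?_ ?_)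
      · exact (continuousAt_id.mul_const B).rpow_const (Or.inl (by simp [hB0.ne']))
      · exact (continuousAt_id.mul_const C).rpow_const (Or.inl (by simp [hC0.ne']))
    have hc2 : ContinuousAt (fun t : ℝ => (A / t) ^ (2 / p)) 1 :=
      (continuousAt_const.div continuousAt_id one_ne_zero).rpow_const
        (Or.inl (by simpa using hA0.ne'))
    have eA : A ^ (2 / p) = (2 * Real.pi / p) ^ ((d : ℝ) / p) := by
      rw [hA, ← Real.rpow_mul (by positivity)]
      congr 1
      field_simp
    have h0 : K * ((1 * B) ^ ϑ * (1 * C) ^ (1 - ϑ)) < (A / 1) ^ (2 / p) := by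
      rw [one_mul, one_mul, div_one, eA, hB,
        Real.mul_rpow (by positivity) hC0.le, mul_assoc, ← Real.rpow_add hC0, add_sub_cancel,
        Real.rpow_one]
      exact hK
    have hev := (hc1.eventually_lt hc2 h0).filter_mono (nhdsWithin_le_nhds (s := Set.Ioi 1))
    obtain ⟨t, h1, h2⟩ := (hev.and self_mem_nhdsWithin).exists
    exact ⟨t, h2, h1⟩
  have ht0 : 0 < t := by linarith
  have l1 := (tendsto_pMass_bumpGaussian χ he rfl hp0 b).eventually (lt_mem_nhds
    (show ENNReal.ofReal (A / t) < ENNReal.ofReal A from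
      (ENNReal.ofReal_lt_ofReal_iff hA0).2 (div_lt_self hA0 ht1)))
  have l2 := (tendsto_mass_bumpGaussian χ he rfl a).eventually (gt_mem_nhds
    (show ENNReal.ofReal C < ENNReal.ofReal (t * C) from
      (ENNReal.ofReal_lt_ofReal_iff (by positivity)).2 (by nlinarith)))
  have l3 := (tendsto_gradEnergy_bumpGaussian χ hd he rfl a).eventually (gt_mem_nhds
    (show ENNReal.ofReal B < ENNReal.ofReal (t * B) from
      (ENNReal.ofReal_lt_ofReal_iff (by positivity)).2 (by nlinarith)))
  obtain ⟨n, ⟨h1, h2⟩, h3⟩ := ((l1.and l2).and l3).exists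
  have hN : (0 : ℝ) < (n : ℝ) + 1 := by positivity
  set N : ℝ := (n : ℝ) + 1
  set T := N ^ d with hT
  have hT0 : 0 < T := by positivity
  refine ⟨bumpGaussian χ N, isTestFunction_bumpGaussian χ N he rfl, fun x hx => ?_,
    N ^ 2 * T⁻¹ * (t * B), T⁻¹ * (t * C), T⁻¹ * (A / t), by positivity, by positivity,
    by positivity, ?_, ?_, ?_, ?_⟩
  · exact support_annulus he (Metric.mem_closedBall.1 (tsupport_bumpGaussian_subset χ N hx))
  · have hpos : 0 < T * (N ^ 2)⁻¹ := by positivity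
    rw [show N ^ 2 * T⁻¹ * (t * B) = t * B / (T * (N ^ 2)⁻¹) by field_simp,
      ENNReal.ofReal_div_of_pos hpos, ENNReal.le_div_iff_mul_le (by simp [hpos]) (by simp),
      mul_comm]
    exact h3.le
  · rw [inv_mul_eq_div, ENNReal.ofReal_div_of_pos hT0,
      ENNReal.le_div_iff_mul_le (by simp [hT0]) (by simp), mul_comm]
    exact h2.le
  · rw [inv_mul_eq_div, ENNReal.ofReal_div_of_pos hT0]
    refine ENNReal.div_le_of_le_mul ?_
    rw [mul_comm]
    exact h1.le
  · have e1 : (N ^ 2) ^ ϑ * T⁻¹ = T⁻¹ ^ (2 / p) := by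
      rw [hT, ← Real.rpow_natCast N d, ← Real.rpow_natCast N 2, ← Real.rpow_neg hN.le,
        ← Real.rpow_mul hN.le, ← Real.rpow_mul hN.le, ← Real.rpow_add hN]
      congr 1
      push_cast
      linarith
    have e2 : (N ^ 2 * T⁻¹ * (t * B)) ^ ϑ * (T⁻¹ * (t * C)) ^ (1 - ϑ) =
        T⁻¹ ^ (2 / p) * ((t * B) ^ ϑ * (t * C) ^ (1 - ϑ)) := by
      rw [← e1, Real.mul_rpow (x := N ^ 2 * T⁻¹) (by positivity) (by positivity),
        Real.mul_rpow (x := N ^ 2) (by positivity) (by positivity),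
        Real.mul_rpow (x := T⁻¹) (by positivity) (by positivity)]
      have e3 : T⁻¹ ^ ϑ * T⁻¹ ^ (1 - ϑ) = T⁻¹ := by
        rw [← Real.rpow_add (inv_pos.2 hT0), add_sub_cancel, Real.rpow_one]
      linear_combination (N ^ 2) ^ ϑ * (t * B) ^ ϑ * (t * C) ^ (1 - ϑ) * e3
    rw [e2, Real.mul_rpow (x := T⁻¹) (by positivity) (by positivity), mul_left_comm]
    exact mul_lt_mul_of_pos_left ht (by positivity)

end CKN

/-! ### Comparison of the constants -/

namespace CKN

variable {d : ℕ}

lemma aBar_vartheta (hd : 2 ≤ d) {p : ℝ} (hp : 2 < p) :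
    aCrit d - aBar d (vartheta p d) p = 2 * ((d : ℝ) - 1) / (p + 2) := by
  have hd' : (2 : ℝ) ≤ d := by exact_mod_cast hd
  have hk : p - 2 ≠ 0 := by linarith
  have hp0 : p ≠ 0 := by linarith
  have e : 2 * p * vartheta p d / (p - 2) - 1 = (d : ℝ) - 1 := by
    rw [vartheta]; field_simp
  rw [aBar, e, sub_sub_cancel, div_mul_eq_mul_div, mul_assoc,
    Real.mul_self_sqrt (by linarith)]

/-- In the limiting case, raised to the power `2 p / (p - 2)` the comparison of the radial constant
with the Gaussian quotient depends on `p` only through the factor `(p + 2) ^ 2`. -/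
lemma radialConst_vartheta_lt (hd : 2 ≤ d) {p : ℝ} (hp : 2 < p)
    (h : (Real.pi * Real.exp 1 / 2) ^ (d : ℝ) *
        ((p + 2) ^ 2 / (4 * ((d : ℝ) - 1))) ^ ((d : ℝ) - 1) <
      (volume : Measure (EuclideanSpace ℝ (Fin d))).toSphere.real Set.univ ^ 2 *
        (27 / 32 * Real.exp 1)) :
    radialConst d p (vartheta p d) (aBar d (vartheta p d) p) *
        (((d : ℝ) / 2) ^ vartheta p d * Real.pi ^ ((d : ℝ) / 2)) <
      (2 * Real.pi / p) ^ ((d : ℝ) / p) := by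
  have hd' : (2 : ℝ) ≤ d := by exact_mod_cast hd
  have : NeZero d := ⟨by omega⟩
  have hp0 : 0 < p := by linarith
  have hk : 0 < p - 2 := by linarith
  have hpi := Real.pi_pos
  have hE := Real.exp_pos 1
  set S := (volume : Measure (EuclideanSpace ℝ (Fin d))).toSphere.real Set.univ with hS
  have hS0 : 0 < S := by
    refine ENNReal.toReal_pos ?_ (measure_ne_top _ _)
    rw [Measure.measure_univ_ne_zero]
    exact Measure.toSphere_ne_zero _
  set n : ℝ := (d : ℝ) - 1 with hn
  have hn0 : 0 < n := by linarith
  have hdn : (d : ℝ) = 1 + n := by rw [hn]; ring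
  set s := (p - 2) / (2 * p) with hs
  have hs0 : 0 < s := by positivity
  have hϑ : vartheta p d = d * s := by rw [vartheta, hs]; field_simp
  have hd0 : (0 : ℝ) < d := by linarith
  set Q := (p + 2) ^ 2 / (4 * n) with hQ
  have hQ0 : 0 < Q := by positivity
  rw [radialConst, rayConst, aBar_vartheta hd hp, ← hS, ← hs, hϑ]
  -- both sides are `s`-th powers, up to a factor estimated by the exponential
  have e1 : S ^ (2 / p - 1) = (S ^ 2)⁻¹ ^ s := by
    rw [← Real.rpow_natCast S 2, ← Real.rpow_neg hS0.le, ← Real.rpow_mul hS0.le]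
    congr 1
    rw [hs]
    push_cast
    field_simp
    ring
  have e2 : s ^ s * ((d * s - s) / (2 * n / (p + 2)) ^ 2) ^ (d * s - s) / (d * s) ^ (d * s) =
      (Q ^ n / (d : ℝ) ^ (d : ℝ)) ^ s := by
    have a1 : (d * s - s) / (2 * n / (p + 2)) ^ 2 = s * Q := by
      rw [hQ, show (d : ℝ) * s - s = n * s by rw [hn]; ring]
      field_simp
      norm_num
    have a2 : (d : ℝ) * s - s = n * s := by rw [hn]; ring
    rw [a1, a2, Real.rpow_mul (show 0 ≤ (d : ℝ) * s by positivity),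
      Real.rpow_mul (show 0 ≤ s * Q by positivity), ← Real.mul_rpow hs0.le (by positivity),
      ← Real.div_rpow (by positivity) (by positivity)]
    congr 1
    rw [Real.mul_rpow hs0.le hQ0.le, Real.mul_rpow hd0.le hs0.le]
    have a3 : s ^ (d : ℝ) = s * s ^ n := by
      rw [hdn, Real.rpow_add hs0, Real.rpow_one]
    rw [a3]
    have : 0 < s ^ n := by positivity
    field_simp
  have e3 : ((d : ℝ) / 2) ^ (d * s) = (((d : ℝ) / 2) ^ (d : ℝ)) ^ s :=
    Real.rpow_mul (by positivity) _ _
  have e4 : (Real.pi ^ (d : ℝ)) ^ s * (2 * Real.pi / p) ^ ((d : ℝ) / p) =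
      Real.pi ^ ((d : ℝ) / 2) * (2 / p) ^ ((d : ℝ) / p) := by
    rw [mul_div_right_comm, mul_comm (2 / p), Real.mul_rpow hpi.le (by positivity),
      ← Real.rpow_mul hpi.le, ← mul_assoc, ← Real.rpow_add hpi]
    congr 2
    rw [hs]
    field_simp
    ring
  have e5 : 1 ≤ (Real.exp 1 ^ (d : ℝ)) ^ s * (2 / p) ^ ((d : ℝ) / p) := by
    have a1 : p / 2 ≤ Real.exp ((p - 2) / 2) := by
      linarith [Real.add_one_le_exp ((p - 2) / 2)]
    have a2 : (p / 2) ^ ((d : ℝ) / p) ≤ (Real.exp 1 ^ (d : ℝ)) ^ s := by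
      calc (p / 2) ^ ((d : ℝ) / p) ≤ Real.exp ((p - 2) / 2) ^ ((d : ℝ) / p) := by gcongr
        _ = _ := by
          rw [← Real.exp_mul, ← Real.rpow_mul hE.le, ← Real.exp_mul, one_mul, hs]
          congr 1
          field_simp
    calc (1 : ℝ) = (p / 2) ^ ((d : ℝ) / p) * (2 / p) ^ ((d : ℝ) / p) := by
          rw [← Real.mul_rpow (by positivity) (by positivity),
            show p / 2 * (2 / p) = 1 by field_simp, Real.one_rpow]
      _ ≤ _ := by gcongr
  have key : (S ^ 2)⁻¹ * (27 / 32 * Real.exp 1)⁻¹ * (Q ^ n / (d : ℝ) ^ (d : ℝ)) *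
      ((d : ℝ) / 2) ^ (d : ℝ) * Real.pi ^ (d : ℝ) * Real.exp 1 ^ (d : ℝ) < 1 := by
    have a1 : (Real.pi * Real.exp 1 / 2) ^ (d : ℝ) * (d : ℝ) ^ (d : ℝ) =
        ((d : ℝ) / 2) ^ (d : ℝ) * Real.pi ^ (d : ℝ) * Real.exp 1 ^ (d : ℝ) := by
      rw [← Real.mul_rpow (by positivity) (by positivity),
        ← Real.mul_rpow (by positivity) (by positivity),
        ← Real.mul_rpow (by positivity) (by positivity)]
      congr 1
      ring
    have a2 : 0 < (d : ℝ) ^ (d : ℝ) := by positivity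
    calc _ = ((Real.pi * Real.exp 1 / 2) ^ (d : ℝ) * Q ^ n) / (S ^ 2 * (27 / 32 * Real.exp 1)) := by
          rw [mul_assoc, mul_assoc, ← mul_assoc (((d : ℝ) / 2) ^ (d : ℝ)), ← a1]
          field_simp
      _ < 1 := (div_lt_one (by positivity)).2 h
  have hlt := Real.rpow_lt_one (by positivity) key hs0
  rw [Real.mul_rpow (by positivity) (by positivity), Real.mul_rpow (by positivity) (by positivity),
    Real.mul_rpow (by positivity) (by positivity), Real.mul_rpow (by positivity) (by positivity),
    Real.mul_rpow (by positivity) (by positivity)] at hlt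
  rw [e1, e2, e3]
  set u1 := (S ^ 2)⁻¹ ^ s
  set u2 := (27 / 32 * Real.exp 1)⁻¹ ^ s
  set u3 := (Q ^ n / (d : ℝ) ^ (d : ℝ)) ^ s
  set u4 := (((d : ℝ) / 2) ^ (d : ℝ)) ^ s
  set u5 := (Real.pi ^ (d : ℝ)) ^ s
  set u6 := (Real.exp 1 ^ (d : ℝ)) ^ s
  set v := (2 * Real.pi / p) ^ ((d : ℝ) / p)
  set w := Real.pi ^ ((d : ℝ) / 2)
  set z := (2 / p) ^ ((d : ℝ) / p)
  have hv : 0 < v := by positivity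
  have hu : 0 < u1 * u2 * u3 * u4 * w := by positivity
  calc u1 * (u2 * u3) * (u4 * w) = u1 * u2 * u3 * u4 * w * 1 := by ring
    _ ≤ u1 * u2 * u3 * u4 * w * (u6 * z) := by gcongr
    _ = (u1 * u2 * u3 * u4 * u5 * u6) * v := by linear_combination -(u1 * u2 * u3 * u4 * u6) * e4
    _ < 1 * v := by gcongr
    _ = v := one_mul _

/-- For `p` close to `2`, the radial constant at the limiting parameters lies strictly below the
quotient of the Gaussian in the Gagliardo-Nirenberg inequality. -/
lemma exists_forall_radialConst_vartheta_lt (hd : 2 ≤ d) :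
    ∃ η : ℝ, 0 < η ∧ ∀ p : ℝ, 2 < p → p < 2 + η → p ≤ 3 ∧ vartheta p d < 1 ∧
      radialConst d p (vartheta p d) (aBar d (vartheta p d) p) *
        (((d : ℝ) / 2) ^ vartheta p d * Real.pi ^ ((d : ℝ) / 2)) <
      (2 * Real.pi / p) ^ ((d : ℝ) / p) := by
  have hd' : (2 : ℝ) ≤ d := by exact_mod_cast hd
  have hn0 : 0 < (d : ℝ) - 1 := by linarith
  have hc : ContinuousAt (fun p : ℝ => (Real.pi * Real.exp 1 / 2) ^ (d : ℝ) *
        ((p + 2) ^ 2 / (4 * ((d : ℝ) - 1))) ^ ((d : ℝ) - 1)) 2 := by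
    refine continuousAt_const.mul (ContinuousAt.rpow_const (by fun_prop) (Or.inr hn0.le))
  have h2 := pi_exp_rpow_lt hd
  have h0 : (Real.pi * Real.exp 1 / 2) ^ (d : ℝ) *
        (((2 : ℝ) + 2) ^ 2 / (4 * ((d : ℝ) - 1))) ^ ((d : ℝ) - 1) <
      (volume : Measure (EuclideanSpace ℝ (Fin d))).toSphere.real Set.univ ^ 2 *
        (27 / 32 * Real.exp 1) := by
    have e : (((2 : ℝ) + 2) ^ 2 / (4 * ((d : ℝ) - 1))) ^ ((d : ℝ) - 1) =
        ((((d : ℝ) - 1) / 4) ^ ((d : ℝ) - 1))⁻¹ := by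
      rw [← Real.inv_rpow (by positivity)]
      congr 1
      field_simp
      norm_num
    rw [e, ← div_eq_mul_inv, div_lt_iff₀ (by positivity)]
    exact h2
  have hv : ContinuousAt (fun p : ℝ => vartheta p d) 2 := by
    unfold vartheta
    exact ContinuousAt.div (by fun_prop) (by fun_prop) (by norm_num)
  have hv0 : vartheta 2 d < 1 := by simp [vartheta]
  obtain ⟨η, hη, hball⟩ := Metric.eventually_nhds_iff_ball.1
    (((hc.eventually_lt_const h0).and (hv.eventually_lt_const hv0)).and
      (eventually_le_nhds (show (2 : ℝ) < 3 by norm_num)))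
  refine ⟨η, hη, fun p hp hp' => ?_⟩
  obtain ⟨⟨h1, h3⟩, h4⟩ := hball p (by
    rw [Metric.mem_ball, Real.dist_eq, abs_of_pos (by linarith)]; linarith)
  exact ⟨h4, h3, radialConst_vartheta_lt hd hp h1⟩

/-! ### Symmetry breaking -/

/-- On the annulus `1 / 2 ≤ ‖x‖ ≤ 2` weights with nearby exponents are comparable. -/
lemma lintegral_annulus_le {f : EuclideanSpace ℝ (Fin d) → ℝ} (hf : ∀ x, 0 ≤ f x)
    (hsupp : ∀ x, f x ≠ 0 → 1 / 2 ≤ ‖x‖ ∧ ‖x‖ ≤ 2) (c c' : ℝ) :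
    ∫⁻ x, ENNReal.ofReal (f x * ‖x‖ ^ c') ≤
      ENNReal.ofReal (2 ^ |c' - c|) * ∫⁻ x, ENNReal.ofReal (f x * ‖x‖ ^ c) := by
  rw [← lintegral_const_mul' _ _ ENNReal.ofReal_ne_top]
  refine lintegral_mono fun x => ?_
  rw [← ENNReal.ofReal_mul (by positivity)]
  refine ENNReal.ofReal_le_ofReal ?_
  by_cases hx : f x = 0
  · simp [hx]
  obtain ⟨h1, h2⟩ := hsupp x hx
  have hpos : 0 < ‖x‖ := by linarith
  calc f x * ‖x‖ ^ c' = ‖x‖ ^ (c' - c) * (f x * ‖x‖ ^ c) := by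
        rw [Real.rpow_sub hpos]
        have : ‖x‖ ^ c ≠ 0 := (Real.rpow_pos_of_pos hpos _).ne'
        field_simp
    _ ≤ _ := by
        have := hf x
        gcongr
        exact rpow_le_two_rpow_abs h1 h2

lemma IsTestFunction.memD {φ : EuclideanSpace ℝ (Fin d) → ℝ} (hφ : IsTestFunction φ) (a : ℝ) :
    MemD a φ (gradient φ) := by
  refine ⟨hφ.1.continuous.aestronglyMeasurable, hφ.continuous_gradient.aestronglyMeasurable,
    fun _ => φ, fun _ => hφ, ?_, ?_⟩ <;> simp [mass, gradEnergy]

lemma le_optConst {φ : EuclideanSpace ℝ (Fin d) → ℝ} (hφ : IsTestFunction φ) {θ p a b : ℝ}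
    (hp : 0 < p) (hθ0 : 0 < θ) (hθ1 : θ < 1) (h0 : pMass b p φ ≠ 0) {K : ℝ≥0∞}
    (h : K * (gradEnergy a (gradient φ) ^ θ * mass a φ ^ (1 - θ)) ≤ pMass b p φ ^ (2 / p)) :
    K ≤ optConst d θ p a b := by
  refine le_sInf fun C hC => ?_
  have h1 := hC φ (gradient φ) (hφ.memD a)
  set D := gradEnergy a (gradient φ) ^ θ * mass a φ ^ (1 - θ) with hD
  have hD0 : D ≠ 0 := by
    intro h2
    rw [h2, mul_zero, nonpos_iff_eq_zero, ENNReal.rpow_eq_zero_iff_of_pos (by positivity)] at h1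
    exact h0 h1
  have hDt : D ≠ ⊤ := ENNReal.mul_ne_top
    (ENNReal.rpow_ne_top_of_nonneg hθ0.le (hφ.gradEnergy_ne_top a))
    (ENNReal.rpow_ne_top_of_nonneg (by linarith) (hφ.mass_ne_top a))
  exact (ENNReal.mul_le_mul_iff_left hD0 hDt).1 (h.trans h1)

lemma pMass_ne_zero (hd : 1 ≤ d) {p b : ℝ} {u : EuclideanSpace ℝ (Fin d) → ℝ}
    (hu : AEStronglyMeasurable u volume) (h0 : ¬ u =ᵐ[volume] 0) : pMass b p u ≠ 0 := by
  have : NeZero d := ⟨by omega⟩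
  intro h
  have m : Measurable fun x : EuclideanSpace ℝ (Fin d) => ‖x‖ ^ (-(b * p)) := by fun_prop
  rw [pMass, lintegral_eq_zero_iff'] at h
  · refine h0 ?_
    filter_upwards [h, compl_mem_ae_iff.2 (measure_singleton (0 : EuclideanSpace ℝ (Fin d)))]
      with x hx hx0
    have hpos : 0 < ‖x‖ ^ (-(b * p)) := Real.rpow_pos_of_pos (norm_pos_iff.2 hx0) _
    rw [Pi.zero_apply, ENNReal.ofReal_eq_zero] at hx
    by_contra hne
    have : 0 < |u x| ^ p * ‖x‖ ^ (-(b * p)) :=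
      mul_pos (Real.rpow_pos_of_pos (abs_pos.2 hne) _) hpos
    linarith
  · exact ((hu.norm.aemeasurable.pow_const p).mul m.aemeasurable).ennreal_ofReal

/-- Radial functions cannot be extremal if the optimal constant exceeds the radial bound. -/
theorem not_isRadial_of_radialConst_lt (hd : 1 ≤ d) {θ p a b K : ℝ} (hp2 : 2 < p) (hp3 : p ≤ 3)
    (hθ : (p - 2) / (2 * p) < θ) (hθ1 : θ < 1) (ha : a < aCrit d) (hb : p = pExp d a b)
    (hK : radialConst d p θ a < K) (hK0 : 0 < K) (hopt : ENNReal.ofReal K ≤ optConst d θ p a b)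
    {u : EuclideanSpace ℝ (Fin d) → ℝ} (hu : IsExtremal θ p a b u) : ¬ IsRadial u := by
  intro hrad
  obtain ⟨hu0, G, hG, heq⟩ := hu
  have hp0 : 0 < p := by linarith
  have hθ0 : 0 < θ := by
    have : 0 < p - 2 := by linarith
    have : 0 < (p - 2) / (2 * p) := by positivity
    linarith
  obtain ⟨hE, hM, -⟩ := hG.lintegral_rayMass_le hd hp2 hp3 hθ hθ1 ha hb
  have h1 := hG.pMass_le_of_isRadial hd hrad hp2 hp3 hθ hθ1 ha hb
  have h2 := pMass_ne_zero (p := p) (b := b) hd hG.1 hu0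
  set D := gradEnergy a G ^ θ * mass a u ^ (1 - θ) with hD
  have hDt : D ≠ ⊤ := ENNReal.mul_ne_top (ENNReal.rpow_ne_top_of_nonneg hθ0.le hE)
    (ENNReal.rpow_ne_top_of_nonneg (by linarith) hM)
  have hD0 : D ≠ 0 := by
    intro h3
    rw [h3, mul_zero, nonpos_iff_eq_zero, ENNReal.rpow_eq_zero_iff_of_pos (by positivity)] at h1
    exact h2 h1
  have h3 : ENNReal.ofReal K * D ≤ ENNReal.ofReal (radialConst d p θ a) * D :=
    calc ENNReal.ofReal K * D ≤ optConst d θ p a b * D := by gcongr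
      _ = pMass b p u ^ (2 / p) := heq.symm
      _ ≤ _ := h1
  have h4 := (ENNReal.mul_le_mul_iff_left hD0 hDt).1 h3
  exact absurd h4 (not_le.2 ((ENNReal.ofReal_lt_ofReal_iff hK0).2 hK))

end CKN

open CKN in
theorem mainTheorem3 (d : ℕ) (hd : 2 ≤ d) :
    ∃ η : ℝ, 0 < η ∧ ∀ p : ℝ, 2 < p → p < 2 + η →
      ∃ ε : ℝ, 0 < ε ∧ ∀ θ : ℝ, CKN.vartheta p d ≤ θ → θ < CKN.vartheta p d + ε →
        ∀ a : ℝ, CKN.aBar d θ p ≤ a → a < CKN.aBar d θ p + ε →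
          θ < 1 ∧ a < CKN.aCrit d ∧ ∀ b : ℝ, p = CKN.pExp d a b →
            ∀ u : EuclideanSpace ℝ (Fin d) → ℝ,
              CKN.IsExtremal θ p a b u → ¬ CKN.IsRadial u := by
  have hd' : (2 : ℝ) ≤ d := by exact_mod_cast hd
  have hd1 : 1 ≤ d := by omega
  obtain ⟨η, hη, hη'⟩ := exists_forall_radialConst_vartheta_lt hd
  refine ⟨η, hη, fun p hp hpη => ?_⟩
  obtain ⟨hp3, hϑ1, hconst⟩ := hη' p hp hpη
  have hp0 : 0 < p := by linarith
  have hk : 0 < p - 2 := by linarith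
  set ϑ := vartheta p d with hϑ
  set a₀ := aBar d ϑ p with ha₀
  have hϑs : (p - 2) / (2 * p) < ϑ := by
    have h1 : 0 < (p - 2) / (2 * p) := by positivity
    have h2 : ϑ = d * ((p - 2) / (2 * p)) := by rw [hϑ, vartheta]; field_simp
    rw [h2]
    nlinarith
  have hϑ0 : 0 < ϑ := lt_trans (by positivity) hϑs
  have hκ : aCrit d - a₀ = 2 * ((d : ℝ) - 1) / (p + 2) := aBar_vartheta hd hp
  have hκ0 : 0 < aCrit d - a₀ := by
    rw [hκ]
    have : 0 < (d : ℝ) - 1 := by linarith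
    positivity
  have hpi := Real.pi_pos
  obtain ⟨K, hK1, hK2⟩ : ∃ K, max 0 (radialConst d p ϑ a₀) < K ∧
      K * (((d : ℝ) / 2) ^ ϑ * Real.pi ^ ((d : ℝ) / 2)) < (2 * Real.pi / p) ^ ((d : ℝ) / p) := by
    have hpos : 0 < ((d : ℝ) / 2) ^ ϑ * Real.pi ^ ((d : ℝ) / 2) := by positivity
    have h2 : max 0 (radialConst d p ϑ a₀) <
        (2 * Real.pi / p) ^ ((d : ℝ) / p) / (((d : ℝ) / 2) ^ ϑ * Real.pi ^ ((d : ℝ) / 2)) :=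
      max_lt (by positivity) ((lt_div_iff₀ hpos).2 hconst)
    obtain ⟨K, h3, h4⟩ := exists_between h2
    exact ⟨K, h3, (lt_div_iff₀ hpos).1 h4⟩
  have hK0 : 0 < K := (le_max_left _ _).trans_lt hK1
  -- the relation between `p`, `a` and `b` says that `b = a + β`
  set β := (d : ℝ) / p - aCrit d with hβ
  obtain ⟨φ, hφ, hφs, E, Y, A, hE, hY, hA, hφE, hφY, hφA, hφK⟩ :=
    exists_isTestFunction_quotient hd1 a₀ (a₀ + β) hp hK2
  -- all conditions are open at `(ϑ, 0)` in the coordinates `(θ, a - aBar d θ p)`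
  have hcB : ContinuousAt (fun z : ℝ × ℝ => aBar d z.1 p + z.2) (ϑ, 0) := by
    unfold aBar
    fun_prop (disch := linarith)
  have hB0 : aBar d ϑ p + 0 = a₀ := add_zero _
  have hev1 : ∀ᶠ z : ℝ × ℝ in 𝓝 (ϑ, 0), z.1 < 1 :=
    continuousAt_fst.eventually_lt_const hϑ1
  have hev2 : ∀ᶠ z : ℝ × ℝ in 𝓝 (ϑ, 0), aBar d z.1 p + z.2 < aCrit d :=
    hcB.eventually_lt_const (by simp only [hB0]; linarith)
  have hev3 : ∀ᶠ z : ℝ × ℝ in 𝓝 (ϑ, 0), radialConst d p z.1 (aBar d z.1 p + z.2) < K := by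
    suffices hc : ContinuousAt (fun z : ℝ × ℝ => radialConst d p z.1 (aBar d z.1 p + z.2)) (ϑ, 0)
      from hc.eventually_lt_const (by simp only [hB0]; exact (le_max_right _ _).trans_lt hK1)
    have hc1 : ContinuousAt (fun z : ℝ × ℝ => z.1 - (p - 2) / (2 * p)) (ϑ, 0) := by fun_prop
    have hc2 : ContinuousAt (fun z : ℝ × ℝ => (aCrit d - (aBar d z.1 p + z.2)) ^ 2) (ϑ, 0) :=
      (continuousAt_const.sub hcB).pow 2
    have hc3 : ContinuousAt (fun z : ℝ × ℝ => z.1 ^ z.1) (ϑ, 0) :=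
      continuousAt_fst.rpow continuousAt_fst (Or.inl hϑ0.ne')
    have hne : (aCrit d - (aBar d ϑ p + 0)) ^ 2 ≠ 0 := by
      rw [hB0]; positivity
    have hs1 : ϑ - (p - 2) / (2 * p) ≠ 0 := by linarith
    unfold radialConst rayConst
    refine continuousAt_const.mul (continuousAt_const.mul (ContinuousAt.div
      (continuousAt_const.mul ((hc1.div hc2 hne).rpow hc1 (Or.inl ?_))) hc3 ?_))
    · exact div_ne_zero hs1 hne
    · exact (Real.rpow_pos_of_pos hϑ0 _).ne'
  have hev4 : ∀ᶠ z : ℝ × ℝ in 𝓝 (ϑ, 0),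
      (4 : ℝ) ^ |aBar d z.1 p + z.2 - a₀| * (4 : ℝ) ^ |aBar d z.1 p + z.2 - a₀| *
        (K * (E ^ z.1 * Y ^ (1 - z.1))) < A ^ (2 / p) := by
    suffices hc : ContinuousAt (fun z : ℝ × ℝ =>
        (4 : ℝ) ^ |aBar d z.1 p + z.2 - a₀| * (4 : ℝ) ^ |aBar d z.1 p + z.2 - a₀| *
        (K * (E ^ z.1 * Y ^ (1 - z.1)))) (ϑ, 0)
      from hc.eventually_lt_const (by simpa [hB0] using hφK)
    have hc4 : ContinuousAt (fun z : ℝ × ℝ => (4 : ℝ) ^ |aBar d z.1 p + z.2 - a₀|) (ϑ, 0) :=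
      continuousAt_const.rpow (hcB.sub continuousAt_const).abs (Or.inl (by norm_num))
    refine (hc4.mul hc4).mul (continuousAt_const.mul (ContinuousAt.mul ?_ ?_))
    · exact continuousAt_const.rpow continuousAt_fst (Or.inl hE.ne')
    · exact continuousAt_const.rpow (continuousAt_const.sub continuousAt_fst) (Or.inl hY.ne')
  obtain ⟨ε, hε, hball⟩ := Metric.eventually_nhds_iff_ball.1
    ((hev1.and hev2).and (hev3.and hev4))
  refine ⟨ε, hε, fun θ hθ hθε a ha haε => ?_⟩
  have hmem : ((θ, a - aBar d θ p) : ℝ × ℝ) ∈ Metric.ball (ϑ, (0 : ℝ)) ε := by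
    rw [Metric.mem_ball, Prod.dist_eq, max_lt_iff, Real.dist_eq, Real.dist_eq,
      abs_of_nonneg (by linarith), abs_of_nonneg (by linarith)]
    constructor <;> linarith
  obtain ⟨⟨h1, h2⟩, h3, h4⟩ := hball _ hmem
  simp only [add_sub_cancel] at h1 h2 h3 h4
  refine ⟨h1, h2, fun b hb u hu => ?_⟩
  have hbβ : b = a + β := by
    have := p_mul_eq hp hb
    rw [hβ]
    field_simp
    linarith
  refine not_isRadial_of_radialConst_lt hd1 hp hp3 (hϑs.trans_le hθ) h1 h2 hb h3 hK0 ?_ hu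
  set t : ℝ := (4 : ℝ) ^ |a - a₀| with ht
  have ht0 : 0 < t := by positivity
  have hθ0 : 0 < θ := hϑ0.trans_le hθ
  have e4 : (2 : ℝ) ^ (2 * |a - a₀|) = t := by
    rw [Real.rpow_mul two_pos.le]
    norm_num [ht]
  have hsφ : ∀ x, φ x ≠ 0 → 1 / 2 ≤ ‖x‖ ∧ ‖x‖ ≤ 2 := fun x hx => hφs x (subset_tsupport φ hx)
  have hgE : gradEnergy a (gradient φ) ≤ ENNReal.ofReal (t * E) := by
    have h := lintegral_annulus_le (f := fun x => ‖gradient φ x‖ ^ 2) (fun x => by positivity)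
      (fun x hx => hφs x ?_) (-(2 * a₀)) (-(2 * a))
    · rw [show -(2 * a) - -(2 * a₀) = -(2 * (a - a₀)) by ring, abs_neg, abs_mul, abs_two, e4] at h
      rw [ENNReal.ofReal_mul ht0.le]
      exact h.trans (by gcongr; exact hφE)
    · by_contra hx'
      have := Function.notMem_support.1 fun h => hx' (support_fderiv_subset ℝ h)
      simp [gradient, this] at hx
  have hmY : mass a φ ≤ ENNReal.ofReal (t * Y) := by
    have h := lintegral_annulus_le (f := fun x => |φ x| ^ 2) (fun x => by positivity)
      (fun x hx => hsφ x fun h => by simp [h] at hx) (-(2 * (a₀ + 1))) (-(2 * (a + 1)))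
    rw [show -(2 * (a + 1)) - -(2 * (a₀ + 1)) = -(2 * (a - a₀)) by ring, abs_neg, abs_mul, abs_two,
      e4] at h
    rw [ENNReal.ofReal_mul ht0.le]
    exact h.trans (by gcongr; exact hφY)
  have hpA : ENNReal.ofReal (A ^ (2 / p) / t) ≤ pMass b p φ ^ (2 / p) := by
    have h := lintegral_annulus_le (f := fun x => |φ x| ^ p) (fun x => by positivity)
      (fun x hx => hsφ x fun h => by simp [h, hp0.ne'] at hx) (-(b * p)) (-((a₀ + β) * p))
    have e5 : |(-((a₀ + β) * p)) - (-(b * p))| = |a - a₀| * p := by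
      rw [hbβ, ← abs_of_pos hp0, ← abs_mul, abs_of_pos hp0]
      congr 1
      ring
    rw [e5] at h
    have h5 := ENNReal.rpow_le_rpow (hφA.trans h) (show 0 ≤ 2 / p by positivity)
    rw [ENNReal.mul_rpow_of_nonneg _ _ (by positivity),
      ENNReal.ofReal_rpow_of_nonneg hA.le (by positivity),
      ENNReal.ofReal_rpow_of_nonneg (by positivity) (by positivity), ← Real.rpow_mul two_pos.le,
      show |a - a₀| * p * (2 / p) = 2 * |a - a₀| by field_simp, e4] at h5
    rw [ENNReal.ofReal_div_of_pos ht0]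
    exact ENNReal.div_le_of_le_mul (by rw [mul_comm]; exact h5)
  refine le_optConst hφ hp0 hθ0 h1 ?_ ?_
  · intro h0
    rw [h0, ENNReal.zero_rpow_of_pos (by positivity), nonpos_iff_eq_zero,
      ENNReal.ofReal_eq_zero] at hpA
    have : 0 < A ^ (2 / p) / t := by positivity
    linarith
  · refine le_trans ?_ hpA
    calc ENNReal.ofReal K * (gradEnergy a (gradient φ) ^ θ * mass a φ ^ (1 - θ))
        ≤ ENNReal.ofReal K * (ENNReal.ofReal (t * E) ^ θ * ENNReal.ofReal (t * Y) ^ (1 - θ)) := by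
          gcongr
      _ = ENNReal.ofReal (K * ((t * E) ^ θ * (t * Y) ^ (1 - θ))) := by
          rw [ENNReal.ofReal_rpow_of_pos (by positivity),
            ENNReal.ofReal_rpow_of_pos (by positivity),
            ← ENNReal.ofReal_mul (by positivity), ← ENNReal.ofReal_mul hK0.le]
      _ ≤ _ := by
          refine ENNReal.ofReal_le_ofReal ?_
          rw [le_div_iff₀ ht0, Real.mul_rpow ht0.le hE.le, Real.mul_rpow ht0.le hY.le]
          have e6 : t ^ θ * t ^ (1 - θ) = t := by
            rw [← Real.rpow_add ht0, add_sub_cancel, Real.rpow_one]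
          refine le_trans (le_of_eq ?_) h4.le
          linear_combination K * E ^ θ * Y ^ (1 - θ) * t * e6
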